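/- **Theorem.** In online bidding with prediction normalized to $P=1$, a deterministic strategy is a bi-infinite strictly increasing sequence $b=(b_n)_{n\in\mathbb Z}$ of positive reals. For a target $T>0$ its cost is $\mathsf{cost}_b(T)=\sum_{n\le n_*}b_n$, where $n_*=\min\{n\in\mathbb Z: b_n\ge T\}$ (and $\mathsf{cost}_b(T)=\infty$ if this minimum does not exist). A randomized strategy $B$ is a probability distribution over deterministic strategies, and $\mathsf{cost}_B(T)$ is its expected cost. $B$ is *$\rho$-robust* if $\mathsf{cost}_B(T)\le\rho T$ for every $T>0$, and *$\chi$-consistent* if $\mathsf{cost}_B(1)\le\chi$. A pair $(\rho,\chi)$ is *Pareto-optimal* if there is a $\rho$-robust $\chi$-consistent randomized strategy, but for no $\rho'<\rho$ is there a $\rho'$-robust $\chi$-consistent randomized strategy. For every $s\in[\ln 2,1]$ the equation $\xi(2-\ln\xi)=e^s$ has a unique solution $\xi=\xi(s)$ in $[1,e]$. For $s\in(0,1]$ put $$\rho(s)=\frac{e^s}{s},\qquad \chi(s)=\begin{cases}(e^s-1)/s, & 0<s<\ln 2,\\ \xi(s)/s, & \ln 2\le s\le 1.\end{cases}$$ Then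 for every $s\in(0,1]$: 1. there exists a randomized strategy that is $\rho(s)$-robust and $\chi(s)$-consistent; 2. the pair $(\rho(s),\chi(s))$ is Pareto-optimal; 3. every $\rho(s)$-robust randomized strategy $B$ satisfies $\mathsf{cost}_B(1)\ge\chi(s)$. -/

import Mathlib

open Set MeasureTheory
open scoped ENNReal

/-- A deterministic bidding strategy: a bi-infinite, strictly increasing sequence of positive bids.
It carries the product σ-algebra inherited from `ℤ → ℝ`. -/
abbrev DetStrategy : Type :=
  {b : ℤ → ℝ // StrictMono b ∧ ∀ n, 0 < b n}

/-- The cost of a deterministic strategy for the target `T`: the sum of all bids up to and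
including the first bid that is at least `T`. The first such index is unique when it exists.
When it does not exist, no bid reaches `T` or all bids are at least `T`; infinitely many bids,
bounded away from `0`, are then submitted, and the cost is `∞` (the infimum over the empty set). -/
noncomputable def DetStrategy.cost (b : DetStrategy) (T : ℝ) : ℝ≥0∞ :=
  ⨅ (n : ℤ) (_ : IsLeast {k : ℤ | T ≤ b.1 k} n), ∑' m : Iic n, ENNReal.ofReal (b.1 m)

/-- A randomized bidding strategy: a probability distribution over deterministic strategies. -/
abbrev RandStrategy : Type :=
  ProbabilityMeasure DetStrategy

/-- The expected cost of a randomized strategy for the target `T`. -/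
noncomputable def RandStrategy.cost (B : RandStrategy) (T : ℝ) : ℝ≥0∞ :=
  ∫⁻ b, DetStrategy.cost b T ∂(B : Measure DetStrategy)

/-- `B` is `ρ`-robust: its expected cost is at most `ρ T` for every target `T > 0`. -/
def IsRobust (B : RandStrategy) (ρ : ℝ) : Prop :=
  ∀ T : ℝ, 0 < T → RandStrategy.cost B T ≤ ENNReal.ofReal (ρ * T)

/-- `B` is `χ`-consistent: its expected cost is at most `χ` when the target equals the prediction,
which is normalized to `1`. -/
def IsConsistent (B : RandStrategy) (χ : ℝ) : Prop :=
  RandStrategy.cost B 1 ≤ ENNReal.ofReal χ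

/-- The pair `(ρ, χ)` is Pareto-optimal: it is attained by a strategy, and no strategy attains
`(ρ', χ)` with `ρ' < ρ`. -/
def IsParetoOptimal (ρ χ : ℝ) : Prop :=
  (∃ B : RandStrategy, IsRobust B ρ ∧ IsConsistent B χ) ∧
    ∀ ρ' : ℝ, ρ' < ρ → ¬ ∃ B : RandStrategy, IsRobust B ρ' ∧ IsConsistent B χ

/-- `ξ` is a solution in `[1, e]` of `ξ (2 - ln ξ) = e ^ s`. -/
def IsXi (s ξ : ℝ) : Prop :=
  ξ ∈ Icc 1 (Real.exp 1) ∧ ξ * (2 - Real.log ξ) = Real.exp s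

/-- The robustness `ρ(s) = e ^ s / s`. -/
noncomputable def rho (s : ℝ) : ℝ := Real.exp s / s

/-- The consistency `χ(s)`, in terms of the function `ξ`. -/
noncomputable def chi (ξ : ℝ → ℝ) (s : ℝ) : ℝ :=
  if s < Real.log 2 then (Real.exp s - 1) / s else ξ s / s

/-!
Write `ρ = rho s`. The tight constraints of the problem become visible after a rearrangement: sort the
bids of all realizations of a randomized strategy together, let `x t` be the bid at expected count
`t`, counted from the prediction `1`, and let `X t` be the expected sum of the bids up to count `t`.

**Lower bound.** A strategy pays, for the target `T`, at least the sum up to one unit of count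
after `T`. So robustness gives `X (t + 1) ≤ ρ X' t` for all `t`, while `X' ≥ 1` on `[0, ∞)`
and the cost of the target `1` is at least `X 1`. Here `X` is not built from quantiles but as the
`envelope` of lines, which makes these facts consequences of one pathwise inequality,
`DetStrategy.line_le_cost`. Since `1 / ρ = s e⁻ˢ`, the function `Z t = e⁻ˢᵗ X t` satisfies
`Z' t ≥ s (Z (t + 1) - Z t)`, so the defect `Z t - s ∫ₜᵗ⁺¹ Z` is nondecreasing. Two minimum
principles exploit this. Towards `-∞` the defect cannot be negative, as `Z` would become negative
(`DefectMono.defect_nonneg`). Towards `+∞`, `Z` may be truncated from above; then it is bounded, and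
for `s < 1` it is nondecreasing (`DefectMono.monotoneOn`). Together they give, for each
`c ∈ [0, 1]`, the bound `s (1 - s (1 - c)) X 1 ≥ eˢ (1 - e⁻ˢᶜ)` (`value_one_lower_bound`). The choice
`c = 1` is optimal for `s < log 2`, and the choice `c = 1 - log ξ / s` otherwise; the value is `χ(s)`.
The case `s = 1` is a limit.

**Upper bound.** The same `c` determines the strategy: bid `x (n + U)`, `n ∈ ℤ`, with `U` uniform on
`(0, 1]`, where `x = 1` on `(0, c]`, `x t = exp (s (t - c))` for `t ≥ c`, and `x t = X (t + 1) / ρ` for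
`t ≤ 0`. The part `t ≤ 0` is found as `x t = eˢᵗ z t` with `z t = s ∫ₜᵗ⁺¹ z`, the minimal
solution of which is a limit of increasing approximations (`averageExt`); exchanging the order of
integration shows that it solves the equation for `x` (`lintegral_exp_mul_eq_of_average`).

**Pareto-optimality.** A strategy with better robustness than `ρ(s)` is `ρ(t)`-robust for some
`t > s`, and for fixed `c` the lower bound strictly increases from `s` to `t`.
-/

open Filter Topology

/-! ### Functions satisfying an advanced differential inequality -/

/-- `Z` satisfies `Z' (t) ≥ s (Z (t + 1) - Z t)` on `[a, ∞)`, where `Z'` is the lower right Dini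
derivative. -/
def AdvanceIneq (s a : ℝ) (Z : ℝ → ℝ) : Prop :=
  ∀ t, a ≤ t → ∀ r, r < s * (Z (t + 1) - Z t) → ∀ᶠ u in 𝓝[>] t, r * (u - t) ≤ Z u - Z t

/-- `Z t - s ∫ₜᵗ⁺¹ Z` is nondecreasing on `[a, ∞)`. -/
def DefectMono (s a : ℝ) (Z : ℝ → ℝ) : Prop :=
  ∀ u v, a ≤ u → u ≤ v →
    Z u - s * ∫ t in u..u + 1, Z t ≤ Z v - s * ∫ t in v..v + 1, Z t

theorem AdvanceIneq.defectMono {s a : ℝ} {Z : ℝ → ℝ} (hZ : Continuous Z)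
    (h : AdvanceIneq s a Z) : DefectMono s a Z := by
  intro u v hu huv
  have hc : Continuous fun t => -(s * (Z (t + 1) - Z t)) := by fun_prop
  have key := image_le_of_liminf_slope_right_le_deriv_boundary (f := fun t => -Z t) (a := u) (b := v)
    (B := fun t => -Z u + ∫ w in u..t, -(s * (Z (w + 1) - Z w)))
    (B' := fun t => -(s * (Z (t + 1) - Z t))) (by fun_prop) (by simp) ?_ ?_ ?_ (right_mem_Icc.2 huv)
  · have h1 : (∫ w in u..v, -(s * (Z (w + 1) - Z w)))
        = -(s * ((∫ w in u..v, Z (w + 1)) - ∫ w in u..v, Z w)) := by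
      rw [intervalIntegral.integral_neg, intervalIntegral.integral_const_mul,
        intervalIntegral.integral_sub ((by fun_prop : Continuous fun w => Z (w + 1)).intervalIntegrable _ _)
          (hZ.intervalIntegrable _ _)]
    have h2 : (∫ w in u..v, Z (w + 1)) = ∫ w in (u + 1)..(v + 1), Z w := by
      simp
    have h3 := intervalIntegral.integral_add_adjacent_intervals (μ := volume)
      (hZ.intervalIntegrable u (u + 1)) (hZ.intervalIntegrable (u + 1) (v + 1))
    have h4 := intervalIntegral.integral_add_adjacent_intervals (μ := volume)
      (hZ.intervalIntegrable u v) (hZ.intervalIntegrable v (v + 1))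
    have h5 : (∫ w in (u + 1)..(v + 1), Z w) - (∫ w in u..v, Z w)
        = (∫ w in v..v + 1, Z w) - ∫ w in u..u + 1, Z w := by linarith
    simp only [h1, h2, h5] at key
    linarith
  · exact fun x _ => (Continuous.continuousWithinAt (by
      exact continuous_const.add (intervalIntegral.continuous_primitive
        (fun a b => hc.intervalIntegrable a b) u)))
  · intro x _
    exact ((intervalIntegral.integral_hasDerivAt_right (hc.intervalIntegrable _ _)
      (hc.stronglyMeasurableAtFilter _ _) hc.continuousAt).const_add _).hasDerivWithinAt
  · intro x hx r hr
    obtain ⟨r', hr1, hr2⟩ := exists_between hr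
    refine Eventually.frequently ?_
    filter_upwards [h x (hu.trans hx.1) (-r') (by linarith), self_mem_nhdsWithin] with z hz hz'
    have hz' : x < z := hz'
    rw [slope_def_field, div_lt_iff₀ (by linarith)]
    nlinarith

/-- Truncation from above preserves the advanced inequality: at a point where `Z ≥ C` the
truncated function cannot grow any more, and its right-hand side is nonpositive. -/
theorem AdvanceIneq.min_const {s a : ℝ} {Z : ℝ → ℝ} (hs : 0 < s) (hZ : Continuous Z)
    (h : AdvanceIneq s a Z) (C : ℝ) : AdvanceIneq s a fun t => min (Z t) C := by
  intro t ht r hr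
  beta_reduce at hr ⊢
  rcases lt_or_ge C (Z t) with hC | hC
  · have hev : ∀ᶠ u in 𝓝[>] t, C < Z u := nhdsWithin_le_nhds (hZ.continuousAt.eventually_const_lt hC)
    filter_upwards [hev, self_mem_nhdsWithin] with u hu hu'
    have hu' : t < u := hu'
    rw [min_eq_right hu.le, min_eq_right hC.le]
    rw [min_eq_right hC.le] at hr
    have : s * (min (Z (t + 1)) C - C) ≤ 0 :=
      mul_nonpos_of_nonneg_of_nonpos hs.le (by linarith [min_le_right (Z (t + 1)) C])
    nlinarith
  · simp only [min_eq_left hC] at hr ⊢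
    have hr1 : r < s * (Z (t + 1) - Z t) :=
      hr.trans_le (mul_le_mul_of_nonneg_left (by linarith [min_le_left (Z (t + 1)) C]) hs.le)
    rcases hC.eq_or_lt with hC | hC
    · have hr0 : r < 0 := hr.trans_le
        (mul_nonpos_of_nonneg_of_nonpos hs.le (by linarith [min_le_right (Z (t + 1)) C]))
      filter_upwards [h t ht r hr1, self_mem_nhdsWithin] with u hu hu'
      have hu' : t < u := hu'
      rcases min_choice (Z u) C with h1 | h1 <;> rw [h1]
      · exact hu
      · rw [hC]; nlinarith
    · have hev : ∀ᶠ u in 𝓝[>] t, Z u < C :=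
        nhdsWithin_le_nhds (hZ.continuousAt.eventually_lt_const hC)
      filter_upwards [hev, h t ht r hr1] with u hu hu'
      rwa [min_eq_left hu.le]

theorem intervalIntegral_le_of_le_one {Z : ℝ → ℝ} (hZ : Continuous Z) {t M : ℝ}
    (h : ∀ u ∈ Icc t (t + 1), Z u ≤ M) : ∫ u in t..t + 1, Z u ≤ M := by
  have := intervalIntegral.integral_mono_on (μ := volume) (by linarith : t ≤ t + 1)
    (hZ.intervalIntegrable _ _) (intervalIntegrable_const (c := M)) h
  simpa using this

/-- A nonnegative `Z` with nondecreasing defect on all of `ℝ` has nonnegative defect: otherwise `Z`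
would drop by a fixed amount on each unit step to the left. -/
theorem DefectMono.defect_nonneg {s : ℝ} {Z : ℝ → ℝ} (hs : 0 < s) (hs1 : s ≤ 1)
    (hZ : Continuous Z) (h0 : ∀ t, 0 ≤ Z t) (h : ∀ a, DefectMono s a Z) :
    s * ∫ t in (0 : ℝ)..1, Z t ≤ Z 0 := by
  by_contra! hlt
  set δ := (s * ∫ t in (0 : ℝ)..1, Z t) - Z 0 with hδ
  have hδ0 : 0 < δ := by linarith
  have hstep : ∀ t ≤ 0, ∀ M, (∀ u ∈ Icc t (t + 1), Z u ≤ M) → Z t ≤ M - δ := by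
    intro t ht M hM
    have h1 := h t t 0 le_rfl ht
    rw [zero_add] at h1
    have h2 := intervalIntegral_le_of_le_one hZ hM
    have hM0 : 0 ≤ M := (h0 t).trans (hM t ⟨le_rfl, by linarith⟩)
    nlinarith [mul_le_mul_of_nonneg_left h2 hs.le]
  obtain ⟨m, hm, hmax⟩ := isCompact_Icc.exists_isMaxOn (nonempty_Icc.2 zero_le_one) hZ.continuousOn
    (s := Icc (0 : ℝ) 1)
  have hbd : ∀ t ≤ 0, ∀ u ∈ Icc t 1, Z u ≤ Z m := by
    intro t ht
    obtain ⟨p, hp, hpmax⟩ := isCompact_Icc.exists_isMaxOn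
      (nonempty_Icc.2 (by linarith : t ≤ 1)) hZ.continuousOn (s := Icc t 1)
    intro u hu
    rcases le_or_gt p 0 with hp0 | hp0
    · have := hstep p hp0 (Z p) fun v hv => hpmax ⟨hp.1.trans hv.1, by linarith [hv.2]⟩
      linarith
    · exact (hpmax hu).trans (hmax ⟨hp0.le, hp.2⟩)
  have hind : ∀ n : ℕ, ∀ t : ℝ, t ≤ 1 - n → Z t ≤ Z m - n * δ := by
    intro n
    induction n with
    | zero =>
      intro t ht
      rcases le_or_gt t 0 with h1 | h1
      · simpa using hbd t h1 t ⟨le_rfl, by linarith⟩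
      · simpa using hmax ⟨h1.le, by simpa using ht⟩
    | succ n ih =>
      intro t ht
      push_cast at ht ⊢
      have := hstep t (by have : (0 : ℝ) ≤ n := n.cast_nonneg
                          linarith) (Z m - n * δ) fun u hu => ih u (by linarith [hu.2])
      linarith
  obtain ⟨n, hn⟩ := exists_nat_gt (Z m / δ)
  rw [div_lt_iff₀ hδ0] at hn
  linarith [hind n (1 - n) le_rfl, h0 (1 - n)]

/-- Minimum principle: every translate difference `W` of `Z` satisfies `W t ≥ s ∫ₜᵗ⁺¹ W`, and
iterating a lower bound for `W` contracts it to `0` because `s < 1`. -/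
theorem DefectMono.monotoneOn {s a C : ℝ} {Z : ℝ → ℝ} (hs : 0 < s) (hs1 : s < 1)
    (hZ : Continuous Z) (h0 : ∀ t, 0 ≤ Z t) (hC : ∀ t, Z t ≤ C) (h : DefectMono s a Z) :
    MonotoneOn Z (Ici a) := by
  intro t₀ ht₀ t₁ _ h01
  set d := t₁ - t₀ with hd
  have hW : Continuous fun t => Z t - Z (t + d) := by fun_prop
  have hind : ∀ n : ℕ, ∀ t, a ≤ t → Z t - Z (t + d) ≤ s ^ n * C := by
    intro n
    induction n with
    | zero => intro t _; simpa using by linarith [h0 (t + d), hC t]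
    | succ n ih =>
      intro t ht
      have h1 := intervalIntegral_le_of_le_one hW (t := t) fun u hu => ih u (ht.trans hu.1)
      rw [intervalIntegral.integral_sub (hZ.intervalIntegrable _ _)
        ((by fun_prop : Continuous fun u => Z (u + d)).intervalIntegrable _ _)] at h1
      have h2 := h t (t + d) ht (by linarith)
      have h3 : (∫ u in t..t + 1, Z (u + d)) = ∫ u in (t + d)..(t + d + 1), Z u := by
        rw [intervalIntegral.integral_comp_add_right]; congr 1; ring
      rw [h3] at h1
      have := mul_le_mul_of_nonneg_left h1 hs.le
      rw [pow_succ]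
      linarith
  have hlim : Tendsto (fun n : ℕ => s ^ n * C) atTop (𝓝 (0 * C)) :=
    (tendsto_pow_atTop_nhds_zero_of_lt_one hs.le hs1).mul_const C
  have := ge_of_tendsto' hlim fun n => hind n t₀ ht₀
  have h4 : t₀ + d = t₁ := by rw [hd]; ring
  rw [h4] at this
  linarith

theorem AdvanceIneq.forward_bound {s c : ℝ} {Z : ℝ → ℝ} (hs : 0 < s) (hs1 : s < 1)
    (hc0 : 0 ≤ c) (hc1 : c ≤ 1) (hZ : Continuous Z) (h0 : ∀ t, 0 ≤ Z t) (h : AdvanceIneq s c Z) :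
    Z c - s * ∫ t in c..1, Z t ≤ (1 - s * (1 - c)) * Z 1 := by
  obtain ⟨m, hm, hmax⟩ := isCompact_Icc.exists_isMaxOn
    (nonempty_Icc.2 (by linarith : c ≤ 2)) hZ.continuousOn (s := Icc c 2)
  set Y : ℝ → ℝ := fun t => min (Z t) (Z m) with hYdef
  have hY : Continuous Y := hZ.min continuous_const
  have hYZ : ∀ t ∈ Icc c 2, Y t = Z t := fun t ht => min_eq_left (hmax ht)
  have hd : DefectMono s c Y := (h.min_const hs hZ _).defectMono hY
  have hmono := hd.monotoneOn hs hs1 hY (fun t => le_min (h0 t) (h0 m)) fun t => min_le_right _ _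
  have h1 := hd c 1 le_rfl hc1
  have hi := fun a b => hY.intervalIntegrable (μ := volume) a b
  have e1 := intervalIntegral.integral_add_adjacent_intervals (hi c 1) (hi 1 (c + 1))
  have e2 := intervalIntegral.integral_add_adjacent_intervals (hi 1 (c + 1)) (hi (c + 1) (1 + 1))
  have h2 : (1 - c) * Y 1 ≤ ∫ t in (c + 1)..(1 + 1), Y t := by
    have := intervalIntegral.integral_mono_on (μ := volume) (by linarith : c + 1 ≤ 1 + 1)
      (intervalIntegrable_const (c := Y 1)) (hi _ _)
      fun t ht => hmono hc1 (show c ≤ t by linarith [ht.1]) (by linarith [ht.1])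
    simpa using this
  have h3 : ∫ t in c..1, Y t = ∫ t in c..1, Z t := by
    refine intervalIntegral.integral_congr fun t ht => ?_
    rw [uIcc_of_le hc1] at ht
    exact hYZ t ⟨ht.1, by linarith [ht.2]⟩
  have h4 := hYZ c ⟨le_rfl, by linarith⟩
  have h5 := hYZ 1 ⟨hc1, by norm_num⟩
  rw [← h3, ← h4, ← h5]
  have := mul_le_mul_of_nonneg_left h2 hs.le
  rw [← e1, ← e2] at h1
  linarith

theorem integral_affine_mul_exp {s : ℝ} (hs : s ≠ 0) (A c : ℝ) :
    s * ∫ u in (0 : ℝ)..c, Real.exp (-(s * u)) * (A + u)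
      = A + 1 / s - Real.exp (-(s * c)) * (A + c + 1 / s) := by
  have hd : ∀ u : ℝ, HasDerivAt (fun u => -(Real.exp (-(s * u)) * (A + u + 1 / s)) / s)
      (Real.exp (-(s * u)) * (A + u)) u := by
    intro u
    have h1 : HasDerivAt (fun u : ℝ => Real.exp (-(s * u))) (Real.exp (-(s * u)) * (-(s * 1))) u :=
      (((hasDerivAt_id u).const_mul s).neg).exp
    have h2 : HasDerivAt (fun u : ℝ => A + u + 1 / s) 1 u :=
      ((hasDerivAt_id u).const_add A).add_const _
    refine ((h1.mul h2).neg.div_const s).congr_deriv ?_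
    field_simp
    ring
  rw [intervalIntegral.integral_eq_sub_of_hasDerivAt (fun u _ => hd u)
    (Continuous.intervalIntegrable (by fun_prop) _ _)]
  simp
  field_simp
  ring

/-- The lower bound on `X 1` for a nonnegative `X` whose slope at `t` is at least
`s e⁻ˢ X (t + 1)`, and at least `1` for `t ≥ 0`. -/
theorem value_one_lower_bound {s c : ℝ} {X : ℝ → ℝ} (hs : 0 < s) (hs1 : s < 1)
    (hc0 : 0 ≤ c) (hc1 : c ≤ 1) (hX : Continuous X) (h0 : ∀ t, 0 ≤ X t)
    (hstep : ∀ t u, t ≤ u → X t + (u - t) * (s * Real.exp (-s) * X (t + 1)) ≤ X u)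
    (hone : ∀ u, 0 ≤ u → X 0 + u ≤ X u) :
    Real.exp s * (1 - Real.exp (-(s * c))) ≤ s * (1 - s * (1 - c)) * X 1 := by
  set Z : ℝ → ℝ := fun t => Real.exp (-(s * t)) * X t with hZdef
  have hZ : Continuous Z := by fun_prop
  have hZ0 : ∀ t, 0 ≤ Z t := fun t => mul_nonneg (Real.exp_pos _).le (h0 t)
  have hadv : ∀ a, AdvanceIneq s a Z := by
    intro a t _ r hr
    set k := s * Real.exp (-s) * X (t + 1) with hk
    have h1 : HasDerivAt (fun u : ℝ => Real.exp (-(s * u))) (Real.exp (-(s * t)) * (-(s * 1))) t :=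
      (((hasDerivAt_id t).const_mul s).neg).exp
    have h2 : HasDerivAt (fun u : ℝ => X t + (u - t) * k) (1 * k) t :=
      ((((hasDerivAt_id t).sub_const t).mul_const k).const_add (X t))
    have h3 := h1.mul h2
    have hval : Real.exp (-(s * t)) * (-(s * 1)) * (X t + (t - t) * k)
        + Real.exp (-(s * t)) * (1 * k) = s * (Z (t + 1) - Z t) := by
      have : Real.exp (-(s * (t + 1))) = Real.exp (-(s * t)) * Real.exp (-s) := by
        rw [← Real.exp_add]; congr 1; ring
      simp only [hZdef, hk, this]; ring
    rw [hval] at h3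
    have h4 := (hasDerivAt_iff_tendsto_slope.1 h3).mono_left
      (nhdsWithin_mono t (fun u (hu : t < u) => hu.ne') : 𝓝[>] t ≤ 𝓝[≠] t)
    filter_upwards [h4.eventually_const_lt hr, self_mem_nhdsWithin] with u hu hu'
    have hu' : t < u := hu'
    rw [slope_def_field, lt_div_iff₀ (by linarith)] at hu
    have := mul_le_mul_of_nonneg_left (hstep t u hu'.le) (Real.exp_pos (-(s * u))).le
    simp only [hZdef, Pi.mul_apply, sub_self, zero_mul, add_zero] at hu ⊢
    linarith
  have hpast := DefectMono.defect_nonneg hs hs1.le hZ hZ0 fun a => (hadv a).defectMono hZ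
  have hfut := (hadv c).forward_bound hs hs1 hc0 hc1 hZ hZ0
  have hsplit := intervalIntegral.integral_add_adjacent_intervals (μ := volume)
    (hZ.intervalIntegrable 0 c) (hZ.intervalIntegrable c 1)
  have hlow := intervalIntegral.integral_mono_on (μ := volume) hc0
    ((by fun_prop : Continuous fun u : ℝ =>
      Real.exp (-(s * u)) * (X 0 + u)).intervalIntegrable _ _) (hZ.intervalIntegrable 0 c)
    fun u hu => mul_le_mul_of_nonneg_left (hone u hu.1) (Real.exp_pos (-(s * u))).le
  have hlow' := mul_le_mul_of_nonneg_left hlow hs.le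
  rw [integral_affine_mul_exp hs.ne'] at hlow'
  have hZc : Real.exp (-(s * c)) * (X 0 + c) ≤ Z c :=
    mul_le_mul_of_nonneg_left (hone c hc0) (Real.exp_pos _).le
  have hZ00 : Z 0 = X 0 := by simp [hZdef]
  have hZ1 : Z 1 = Real.exp (-s) * X 1 := by simp [hZdef]
  rw [hZ1] at hfut
  rw [← hsplit, hZ00, mul_add] at hpast
  have hmain : 1 / s * (1 - Real.exp (-(s * c))) ≤ (1 - s * (1 - c)) * (Real.exp (-s) * X 1) := by
    linarith
  have := mul_le_mul_of_nonneg_left hmain (mul_pos hs (Real.exp_pos s)).le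
  have he : Real.exp s * Real.exp (-s) = 1 := by rw [← Real.exp_add]; simp
  calc Real.exp s * (1 - Real.exp (-(s * c)))
      = s * Real.exp s * (1 / s * (1 - Real.exp (-(s * c)))) := by field_simp
    _ ≤ _ := this
    _ = s * (1 - s * (1 - c)) * X 1 * (Real.exp s * Real.exp (-s)) := by ring
    _ = _ := by rw [he, mul_one]

/-! ### Envelopes of lines -/

/-- The upper envelope of the lines `t ↦ F y + y (t - τ y)`. When `τ y` counts (relatively) the
expected number of bids below `y`, and `F y` is their expected sum, this is the expected sum of the
bids up to count `t`, if the bids of all realizations are sorted together. -/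
noncomputable def envelope (F τ : ℝ → ℝ) (t : ℝ) : ℝ :=
  ⨆ y : Ioi (0 : ℝ), (F y + y * (t - τ y))

section Envelope

variable {F τ C : ℝ → ℝ}

theorem bddAbove_envelope
    (hC : ∀ T y, 0 < T → 0 < y → F y + y * (1 + τ T - τ y) ≤ C T)
    (hτ : ∀ t, ∃ T, 0 < T ∧ t ≤ τ T) (t : ℝ) :
    BddAbove (range fun y : Ioi (0 : ℝ) => F y + y * (t - τ y)) := by
  obtain ⟨T, hT, htT⟩ := hτ t
  refine ⟨C T, ?_⟩
  rintro _ ⟨⟨y, hy⟩, rfl⟩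
  have hy : 0 < y := hy
  refine le_trans ?_ (hC T y hT hy)
  have := mul_le_mul_of_nonneg_left (by linarith : t - τ y ≤ 1 + τ T - τ y) hy.le
  simpa using this

theorem envelope_mono (hb : ∀ t, BddAbove (range fun y : Ioi (0 : ℝ) => F y + y * (t - τ y))) :
    Monotone (envelope F τ) := by
  intro t u htu
  refine ciSup_mono (hb u) fun ⟨y, hy⟩ => ?_
  have hy : 0 < y := hy
  have := mul_le_mul_of_nonneg_left (by linarith : t - τ y ≤ u - τ y) hy.le
  simpa using this

theorem line_le_envelope (hb : ∀ t, BddAbove (range fun y : Ioi (0 : ℝ) => F y + y * (t - τ y)))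
    {y : ℝ} (hy : 0 < y) (t : ℝ) : F y + y * (t - τ y) ≤ envelope F τ t :=
  le_ciSup (hb t) (⟨y, hy⟩ : Ioi (0 : ℝ))

theorem envelope_le {t M : ℝ} (h : ∀ y, 0 < y → F y + y * (t - τ y) ≤ M) : envelope F τ t ≤ M :=
  haveI : Nonempty (Ioi (0 : ℝ)) := ⟨⟨1, mem_Ioi.2 one_pos⟩⟩
  ciSup_le fun y => h y y.2

theorem envelope_continuous
    (hb : ∀ t, BddAbove (range fun y : Ioi (0 : ℝ) => F y + y * (t - τ y))) :
    Continuous (envelope F τ) := by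
  have hconv : ConvexOn ℝ univ (envelope F τ) := by
    refine ⟨convex_univ, fun t _ u _ a b ha hb' hab => envelope_le fun y hy => ?_⟩
    have h1 := mul_le_mul_of_nonneg_left (line_le_envelope hb hy t) ha
    have h2 := mul_le_mul_of_nonneg_left (line_le_envelope hb hy u) hb'
    simp only [smul_eq_mul]
    have hb1 : b = 1 - a := by linarith
    subst hb1
    linarith
  exact continuousOn_univ.1 (hconv.continuousOn isOpen_univ)

theorem envelope_nonneg (hb : ∀ t, BddAbove (range fun y : Ioi (0 : ℝ) => F y + y * (t - τ y)))
    (hF : ∀ y, 0 < y → 0 ≤ F y) (hτ1 : ∀ y, 0 < y → y ≤ 1 → τ y ≤ 0) (t : ℝ) :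
    0 ≤ envelope F τ t := by
  refine le_of_forall_pos_lt_add fun ε hε => ?_
  obtain ⟨y, hy0, hy⟩ := exists_between (show 0 < min 1 (ε / (|t| + 1)) by positivity)
  have h1 := line_le_envelope hb hy0 t
  have h2 := hF y hy0
  have h3 := hτ1 y hy0 (hy.le.trans (min_le_left _ _))
  have h4 := hy.trans_le (min_le_right _ _)
  rw [lt_div_iff₀ (by positivity)] at h4
  nlinarith [neg_abs_le t, mul_le_mul_of_nonneg_left (neg_abs_le t) hy0.le]

/-- The envelope has slope at least `q` to the right of `τ q`. -/
theorem envelope_slope (hb : ∀ t, BddAbove (range fun y : Ioi (0 : ℝ) => F y + y * (t - τ y)))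
    (hF : ∀ q y, 0 < q → 0 < y → F y + y * (τ q - τ y) ≤ F q)
    {q t u : ℝ} (hq : 0 < q) (hqt : τ q ≤ t) (htu : t ≤ u) :
    envelope F τ t + (u - t) * q ≤ envelope F τ u := by
  rw [← le_sub_iff_add_le]
  refine envelope_le fun y hy => ?_
  rw [le_sub_iff_add_le]
  rcases le_or_gt q y with h | h
  · have := line_le_envelope hb hy u
    nlinarith
  · have h1 := line_le_envelope hb hq u
    have h2 := hF q y hq hy
    nlinarith

theorem envelope_step {ρ : ℝ} (hρ : 0 < ρ)
    (hb : ∀ t, BddAbove (range fun y : Ioi (0 : ℝ) => F y + y * (t - τ y)))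
    (hF : ∀ q y, 0 < q → 0 < y → F y + y * (τ q - τ y) ≤ F q)
    (hC : ∀ T y, 0 < T → 0 < y → F y + y * (1 + τ T - τ y) ≤ C T)
    (hCρ : ∀ T, 0 < T → C T ≤ ρ * T) {t u : ℝ} (htu : t ≤ u) :
    envelope F τ t + (u - t) * (envelope F τ (t + 1) / ρ) ≤ envelope F τ u := by
  rcases htu.eq_or_lt with rfl | htu
  · simp
  by_contra! hlt
  have hmono := envelope_mono hb
  have hut : 0 < u - t := by linarith
  obtain ⟨q, hq1, hq2⟩ : ∃ q, (envelope F τ u - envelope F τ t) / (u - t) < q ∧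
      q < envelope F τ (t + 1) / ρ := by
    apply exists_between
    rw [div_lt_iff₀ hut]
    linarith
  have hq0 : 0 < q := lt_of_le_of_lt (div_nonneg (by linarith [hmono htu.le]) hut.le) hq1
  have hτq : τ q ≤ t := by
    by_contra! hlt'
    have h1 : envelope F τ (t + 1) ≤ C q := envelope_le fun y hy => by
      have := mul_le_mul_of_nonneg_left (by linarith : t + 1 - τ y ≤ 1 + τ q - τ y) hy.le
      linarith [hC q y hq0 hy]
    rw [lt_div_iff₀ hρ] at hq2
    linarith [hCρ q hq0]
  have := envelope_slope hb hF hq0 hτq htu.le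
  rw [div_lt_iff₀ hut] at hq1
  linarith

end Envelope

/-! ### Deterministic strategies -/

namespace DetStrategy

/-- The sum of all bids with index less than `n`. -/
noncomputable def partialSum (b : DetStrategy) (n : ℤ) : ℝ≥0∞ :=
  ∑' m : ℤ, if m < n then ENNReal.ofReal (b.1 m) else 0

/-- The sum of all bids below `T`. -/
noncomputable def sumBelow (b : DetStrategy) (T : ℝ) : ℝ≥0∞ :=
  ∑' m : ℤ, if b.1 m < T then ENNReal.ofReal (b.1 m) else 0

open Classical in
/-- The index of the first bid that is at least `T`; it is `0` if there is no first such bid. -/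
noncomputable def firstIndex (b : DetStrategy) (T : ℝ) : ℤ :=
  if h : ∃ n, IsLeast {k : ℤ | T ≤ b.1 k} n then h.choose else 0

variable {b : DetStrategy} {T : ℝ} {n : ℤ}

theorem isLeast_iff : IsLeast {k : ℤ | T ≤ b.1 k} n ↔ T ≤ b.1 n ∧ b.1 (n - 1) < T := by
  constructor
  · intro h
    refine ⟨h.1, ?_⟩
    by_contra! h'
    have := h.2 h'
    omega
  · intro h
    refine ⟨h.1, fun k hk => ?_⟩
    by_contra! hkn
    have := b.2.1.monotone (show k ≤ n - 1 by omega)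
    have hk : T ≤ b.1 k := hk
    linarith [h.2]

theorem firstIndex_eq (h : IsLeast {k : ℤ | T ≤ b.1 k} n) : b.firstIndex T = n := by
  have h' : ∃ n, IsLeast {k : ℤ | T ≤ b.1 k} n := ⟨n, h⟩
  rw [firstIndex, dif_pos h']
  exact h'.choose_spec.unique h

theorem partialSum_succ (b : DetStrategy) (n : ℤ) :
    b.partialSum (n + 1) = b.partialSum n + ENNReal.ofReal (b.1 n) := by
  have : ENNReal.ofReal (b.1 n) = ∑' m : ℤ, if m = n then ENNReal.ofReal (b.1 m) else 0 := by
    rw [tsum_ite_eq]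
  rw [partialSum, partialSum, this, ← ENNReal.tsum_add]
  refine tsum_congr fun m => ?_
  rcases lt_trichotomy m n with h | h | h
  · simp [h, h.ne, (by omega : m < n + 1)]
  · simp [h]
  · rw [if_neg (by omega), if_neg (by omega), if_neg (by omega), add_zero]

theorem cost_eq (h : IsLeast {k : ℤ | T ≤ b.1 k} n) : b.cost T = b.partialSum (n + 1) := by
  have h1 : b.cost T = ∑' m : Iic n, ENNReal.ofReal (b.1 m) := by
    refine le_antisymm (iInf₂_le n h) (le_iInf₂ fun k hk => ?_)
    rw [hk.unique h]
  rw [h1, tsum_subtype (Iic n) fun m => ENNReal.ofReal (b.1 m), partialSum]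
  refine tsum_congr fun m => ?_
  simp [indicator]

theorem exists_isLeast_of_cost_ne_top (h : b.cost T ≠ ∞) :
    ∃ n, IsLeast {k : ℤ | T ≤ b.1 k} n := by
  by_contra! h'
  exact h (by simp [cost, h'])

theorem isLeast_firstIndex (h : b.cost T ≠ ∞) :
    IsLeast {k : ℤ | T ≤ b.1 k} (b.firstIndex T) := by
  obtain ⟨n, hn⟩ := exists_isLeast_of_cost_ne_top h
  rwa [firstIndex_eq hn]

theorem sumBelow_eq (h : IsLeast {k : ℤ | T ≤ b.1 k} n) : b.sumBelow T = b.partialSum n := by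
  refine tsum_congr fun m => ?_
  have : b.1 m < T ↔ m < n := by
    refine ⟨fun hm => ?_, fun hm => ?_⟩
    · by_contra! hnm
      exact absurd hm (not_lt.2 (le_trans h.1 (b.2.1.monotone hnm)))
    · by_contra! hT
      exact absurd (h.2 hT) (not_le.2 hm)
  simp only [this]

theorem partialSum_ne_top (h : b.partialSum n ≠ ∞) (k : ℤ) : b.partialSum k ≠ ∞ := by
  have hiff : ∀ j, b.partialSum (j + 1) ≠ ∞ ↔ b.partialSum j ≠ ∞ := fun j => by
    rw [partialSum_succ]; simp
  induction k using Int.inductionOn' (b := n) with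
  | zero => exact h
  | succ k _ ih => exact (hiff k).2 ih
  | pred k _ ih => exact (hiff (k - 1)).1 (by rwa [sub_add_cancel])

theorem toReal_partialSum_succ (h : ∀ k, b.partialSum k ≠ ∞) (n : ℤ) :
    (b.partialSum (n + 1)).toReal = (b.partialSum n).toReal + b.1 n := by
  rw [partialSum_succ, ENNReal.toReal_add (h n) ENNReal.ofReal_ne_top,
    ENNReal.toReal_ofReal (b.2.2 n).le]

/-- The partial sums are convex in the index, so that they lie above the line of slope `T` through
the partial sum of the bids below `T`. -/
theorem line_le_partialSum (hT : b.cost T ≠ ∞) (k : ℤ) :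
    (b.sumBelow T).toReal + T * (k - b.firstIndex T) ≤ (b.partialSum k).toReal := by
  have hl := isLeast_firstIndex hT
  rw [cost_eq hl] at hT
  have hfin := partialSum_ne_top hT
  rw [sumBelow_eq hl]
  induction k using Int.inductionOn' (b := b.firstIndex T) with
  | zero => simp
  | succ k hk ih =>
    rw [toReal_partialSum_succ hfin]
    have h1 : T ≤ b.1 k := le_trans hl.1 (b.2.1.monotone hk)
    push_cast
    linarith
  | pred k hk ih =>
    have h1 := toReal_partialSum_succ hfin (k - 1)
    have h2 : b.1 (k - 1) < T := by
      by_contra! h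
      have := hl.2 h
      omega
    rw [sub_add_cancel] at h1
    push_cast
    linarith

theorem line_le_cost {y : ℝ} (hT : b.cost T ≠ ∞) (hy : b.cost y ≠ ∞) :
    (b.sumBelow y).toReal + y * (1 + b.firstIndex T - b.firstIndex y) ≤ (b.cost T).toReal := by
  have := line_le_partialSum hy (b.firstIndex T + 1)
  rw [cost_eq (isLeast_firstIndex hT)]
  push_cast at this
  linarith

theorem line_le_sumBelow {y : ℝ} (hT : b.cost T ≠ ∞) (hy : b.cost y ≠ ∞) :
    (b.sumBelow y).toReal + y * (b.firstIndex T - b.firstIndex y) ≤ (b.sumBelow T).toReal := by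
  have := line_le_partialSum hy (b.firstIndex T)
  rwa [sumBelow_eq (isLeast_firstIndex hT)]

theorem sumBelow_le_cost (b : DetStrategy) (T : ℝ) : b.sumBelow T ≤ b.cost T := by
  by_cases h : b.cost T = ∞
  · simp [h]
  · have hl := isLeast_firstIndex h
    rw [cost_eq hl, sumBelow_eq hl, partialSum_succ]
    exact le_self_add

theorem measurable_bid (n : ℤ) : Measurable fun b : DetStrategy => b.1 n :=
  (measurable_pi_apply n).comp measurable_subtype_coe

theorem measurable_partialSum (n : ℤ) : Measurable fun b : DetStrategy => b.partialSum n := by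
  refine Measurable.tsum fun m => ?_
  by_cases h : m < n
  · simpa [h] using (measurable_bid m).ennreal_ofReal
  · simp [h]

theorem measurable_sumBelow (T : ℝ) : Measurable fun b : DetStrategy => b.sumBelow T :=
  Measurable.tsum fun m => Measurable.ite
    (measurableSet_lt (measurable_bid m) measurable_const) (measurable_bid m).ennreal_ofReal
    measurable_const

theorem measurableSet_isLeast (T : ℝ) (n : ℤ) :
    MeasurableSet {b : DetStrategy | IsLeast {k : ℤ | T ≤ b.1 k} n} := by
  simp only [isLeast_iff]
  exact (measurableSet_le measurable_const (measurable_bid n)).inter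
    (measurableSet_lt (measurable_bid _) measurable_const)

theorem measurable_cost (T : ℝ) : Measurable fun b : DetStrategy => b.cost T := by
  classical
  have : (fun b : DetStrategy => b.cost T) = fun b : DetStrategy =>
      ⨅ n : ℤ, if IsLeast {k : ℤ | T ≤ b.1 k} n then b.partialSum (n + 1) else ∞ := by
    funext b
    refine iInf_congr fun n => ?_
    by_cases h : IsLeast {k : ℤ | T ≤ b.1 k} n
    · rw [if_pos h, iInf_pos h, ← cost_eq h, cost]
      refine le_antisymm (le_iInf₂ fun k hk => by rw [hk.unique h]) (iInf₂_le n h)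
    · rw [if_neg h, iInf_neg h]
  rw [this]
  exact Measurable.iInf fun n => Measurable.ite (measurableSet_isLeast T n)
    (measurable_partialSum _) measurable_const

theorem measurable_firstIndex (T : ℝ) : Measurable fun b : DetStrategy => b.firstIndex T := by
  refine measurable_to_countable' fun n => ?_
  have hex : MeasurableSet {b : DetStrategy | ∃ n, IsLeast {k : ℤ | T ≤ b.1 k} n} := by
    simp only [ofPred_exists]
    exact MeasurableSet.iUnion fun n => measurableSet_isLeast T n
  have : (fun b : DetStrategy => b.firstIndex T) ⁻¹' {n}
      = {b : DetStrategy | IsLeast {k : ℤ | T ≤ b.1 k} n} ∪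
        ({b : DetStrategy | ∃ n, IsLeast {k : ℤ | T ≤ b.1 k} n}ᶜ ∩ {_b | (0 : ℤ) = n}) := by
    ext b
    simp only [mem_preimage, mem_singleton_iff, mem_union, mem_inter_iff, mem_compl_iff,
      mem_ofPred_eq]
    constructor
    · intro h
      by_cases hb : ∃ n, IsLeast {k : ℤ | T ≤ b.1 k} n
      · obtain ⟨k, hk⟩ := hb
        rw [firstIndex_eq hk] at h
        exact Or.inl (h ▸ hk)
      · rw [firstIndex, dif_neg hb] at h
        exact Or.inr ⟨hb, h⟩
    · rintro (h | ⟨h, h'⟩)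
      · exact firstIndex_eq h
      · rw [firstIndex, dif_neg h, h']
  rw [this]
  exact (measurableSet_isLeast T n).union (hex.compl.inter (MeasurableSet.const _))

end DetStrategy

/-! ### Mean counts and sums of a randomized strategy -/

namespace RandStrategy

variable {B : RandStrategy}

/-- The expected sum of the bids below `T`. -/
noncomputable def meanSum (B : RandStrategy) (T : ℝ) : ℝ :=
  ∫ b, (DetStrategy.sumBelow b T).toReal ∂(B : Measure DetStrategy)

/-- The expected number of bids in `[1, T)`, or minus the expected number of bids in `[T, 1)`. -/
noncomputable def meanCount (B : RandStrategy) (T : ℝ) : ℝ :=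
  ∫ b, ((DetStrategy.firstIndex b T : ℝ) - DetStrategy.firstIndex b 1) ∂(B : Measure DetStrategy)

theorem ae_cost_ne_top {T : ℝ} (h : B.cost T ≠ ∞) :
    ∀ᵐ b ∂(B : Measure DetStrategy), DetStrategy.cost b T ≠ ∞ :=
  (ae_lt_top (DetStrategy.measurable_cost T) h).mono fun _ => ne_of_lt

theorem integrable_cost {T : ℝ} (h : B.cost T ≠ ∞) :
    Integrable (fun b => (DetStrategy.cost b T).toReal) (B : Measure DetStrategy) :=
  integrable_toReal_of_lintegral_ne_top (DetStrategy.measurable_cost T).aemeasurable h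

theorem integral_cost {T : ℝ} (h : B.cost T ≠ ∞) :
    ∫ b, (DetStrategy.cost b T).toReal ∂(B : Measure DetStrategy) = (B.cost T).toReal :=
  integral_toReal (DetStrategy.measurable_cost T).aemeasurable
    (ae_lt_top (DetStrategy.measurable_cost T) h)

theorem integrable_sumBelow {T : ℝ} (h : B.cost T ≠ ∞) :
    Integrable (fun b => (DetStrategy.sumBelow b T).toReal) (B : Measure DetStrategy) :=
  integrable_toReal_of_lintegral_ne_top (DetStrategy.measurable_sumBelow T).aemeasurable
    (ne_top_of_le_ne_top h (lintegral_mono fun b => DetStrategy.sumBelow_le_cost b T))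

theorem measurable_count (T : ℝ) : Measurable fun b : DetStrategy =>
    (DetStrategy.firstIndex b T : ℝ) - DetStrategy.firstIndex b 1 :=
  ((measurable_of_countable (fun n : ℤ => (n : ℝ))).comp (DetStrategy.measurable_firstIndex T)).sub
    ((measurable_of_countable (fun n : ℤ => (n : ℝ))).comp (DetStrategy.measurable_firstIndex 1))

theorem integrable_count {T : ℝ} (hT : 0 < T) (h : B.cost T ≠ ∞) (h1 : B.cost 1 ≠ ∞) :
    Integrable (fun b => (DetStrategy.firstIndex b T : ℝ) - DetStrategy.firstIndex b 1)
      (B : Measure DetStrategy) := by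
  refine ((integrable_cost h).add ((integrable_cost h1).div_const T)).mono'
    (measurable_count T).aestronglyMeasurable ?_
  filter_upwards [ae_cost_ne_top h, ae_cost_ne_top h1] with b hb hb1
  have e1 := DetStrategy.line_le_sumBelow hb hb1
  have e2 := DetStrategy.line_le_sumBelow hb1 hb
  have e3 := ENNReal.toReal_mono hb (DetStrategy.sumBelow_le_cost b T)
  have e4 := ENNReal.toReal_mono hb1 (DetStrategy.sumBelow_le_cost b 1)
  have p1 : 0 ≤ (DetStrategy.sumBelow b 1).toReal := ENNReal.toReal_nonneg
  have p2 : 0 ≤ (DetStrategy.sumBelow b T).toReal := ENNReal.toReal_nonneg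
  have p3 : 0 ≤ (DetStrategy.cost b 1).toReal / T := by positivity
  have p4 : 0 ≤ (DetStrategy.cost b T).toReal := ENNReal.toReal_nonneg
  have e5 : (DetStrategy.firstIndex b 1 : ℝ) - DetStrategy.firstIndex b T
      ≤ (DetStrategy.cost b 1).toReal / T := by
    rw [le_div_iff₀ hT]; linarith
  rw [Real.norm_eq_abs, abs_le, Pi.add_apply]
  constructor <;> linarith

variable (hB : ∀ T, 0 < T → B.cost T ≠ ∞)
include hB

theorem meanSum_add_le_cost {T y : ℝ} (hT : 0 < T) (hy : 0 < y) :
    B.meanSum y + y * (1 + B.meanCount T - B.meanCount y) ≤ (B.cost T).toReal := by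
  have iT := integrable_count hT (hB T hT) (hB 1 one_pos)
  have iy := integrable_count hy (hB y hy) (hB 1 one_pos)
  have iF := integrable_sumBelow (hB y hy)
  have h := integral_mono_ae (μ := (B : Measure DetStrategy))
    (iF.add (((integrable_const 1).add (iT.sub iy)).const_mul y)) (integrable_cost (hB T hT)) (by
      filter_upwards [ae_cost_ne_top (hB T hT), ae_cost_ne_top (hB y hy)] with b h1 h2
      have := DetStrategy.line_le_cost h1 h2
      simp only [Pi.add_apply, Pi.sub_apply]
      linarith)
  rw [integral_cost (hB T hT), integral_add' iF (((integrable_const 1).add (iT.sub iy)).const_mul y),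
    integral_const_mul, integral_add' (integrable_const 1) (iT.sub iy), integral_sub' iT iy] at h
  simp only [integral_const, probReal_univ, smul_eq_mul, mul_one] at h
  rw [meanSum, meanCount, meanCount]
  linarith

theorem meanSum_add_le_meanSum {T y : ℝ} (hT : 0 < T) (hy : 0 < y) :
    B.meanSum y + y * (B.meanCount T - B.meanCount y) ≤ B.meanSum T := by
  have iT := integrable_count hT (hB T hT) (hB 1 one_pos)
  have iy := integrable_count hy (hB y hy) (hB 1 one_pos)
  have iF := integrable_sumBelow (hB y hy)
  have h := integral_mono_ae (μ := (B : Measure DetStrategy))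
    (iF.add ((iT.sub iy).const_mul y)) (integrable_sumBelow (hB T hT)) (by
      filter_upwards [ae_cost_ne_top (hB T hT), ae_cost_ne_top (hB y hy)] with b h1 h2
      have := DetStrategy.line_le_sumBelow h1 h2
      simp only [Pi.add_apply, Pi.sub_apply]
      linarith)
  rw [integral_add' iF ((iT.sub iy).const_mul y),
    integral_const_mul, integral_sub' iT iy] at h
  exact h

theorem meanCount_nonpos {y : ℝ} (hy : 0 < y) (hy1 : y ≤ 1) : B.meanCount y ≤ 0 := by
  refine integral_nonpos_of_ae ?_
  filter_upwards [ae_cost_ne_top (hB y hy), ae_cost_ne_top (hB 1 one_pos)] with b h1 h2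
  have := (DetStrategy.isLeast_firstIndex h1).2
    (show y ≤ b.1 (b.firstIndex 1) from hy1.trans (DetStrategy.isLeast_firstIndex h2).1)
  have : (b.firstIndex y : ℝ) ≤ b.firstIndex 1 := by exact_mod_cast this
  simpa using this

/-- Almost surely the bids are unbounded and finitely many lie in each `[1, T)`, so that their
number tends to infinity with `T`, and so does its mean by Fatou's lemma. -/
theorem exists_le_meanCount (t : ℝ) : ∃ T, 0 < T ∧ t ≤ B.meanCount T := by
  by_contra! hlt
  set f : ℕ → DetStrategy → ℝ≥0∞ := fun k b =>
    ENNReal.ofReal ((DetStrategy.firstIndex b ((k : ℝ) + 1) : ℝ) - DetStrategy.firstIndex b 1)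
    with hf
  have hall : ∀ᵐ b ∂(B : Measure DetStrategy), ∀ k : ℕ, DetStrategy.cost b ((k : ℝ) + 1) ≠ ∞ :=
    ae_all_iff.2 fun k => ae_cost_ne_top (hB _ (by positivity))
  have hbd : ∀ k, ∫⁻ b, f k b ∂(B : Measure DetStrategy) ≤ ENNReal.ofReal t := by
    intro k
    have hk : (0 : ℝ) < (k : ℝ) + 1 := by positivity
    rw [← ofReal_integral_eq_lintegral_ofReal (integrable_count hk (hB _ hk) (hB 1 one_pos))]
    · exact ENNReal.ofReal_le_ofReal (hlt _ hk).le
    · filter_upwards [ae_cost_ne_top (hB _ hk), ae_cost_ne_top (hB 1 one_pos)] with b h1 h2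
      have := (DetStrategy.isLeast_firstIndex h2).2
        (show 1 ≤ b.1 (b.firstIndex ((k : ℝ) + 1)) from
          le_trans (by simp) (DetStrategy.isLeast_firstIndex h1).1)
      have : (b.firstIndex 1 : ℝ) ≤ b.firstIndex ((k : ℝ) + 1) := by exact_mod_cast this
      simpa using this
  have hfatou := lintegral_liminf_le (μ := (B : Measure DetStrategy)) (u := atTop) (f := f)
    fun k => (measurable_count _).ennreal_ofReal
  have hlim : ∀ᵐ b ∂(B : Measure DetStrategy), liminf (fun k => f k b) atTop = ∞ := by
    filter_upwards [hall] with b hb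
    refine Tendsto.liminf_eq (ENNReal.tendsto_ofReal_atTop.comp ?_)
    refine tendsto_atTop_add_const_right _ _ (tendsto_atTop.2 fun r => ?_)
    obtain ⟨n, hn⟩ := exists_nat_gt r
    filter_upwards [eventually_ge_atTop ⌈b.1 n⌉₊] with k hk
    have hk' : b.1 n ≤ k := (Nat.le_ceil _).trans (by exact_mod_cast hk)
    have h1 : (k : ℝ) + 1 ≤ b.1 (b.firstIndex ((k : ℝ) + 1)) :=
      (DetStrategy.isLeast_firstIndex (hb k)).1
    have h2 : (n : ℤ) < b.firstIndex ((k : ℝ) + 1) := b.2.1.lt_iff_lt.1 (by linarith)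
    have h3 : ((n : ℤ) : ℝ) < b.firstIndex ((k : ℝ) + 1) := by exact_mod_cast h2
    push_cast at h3
    linarith
  rw [lintegral_congr_ae hlim, lintegral_const, measure_univ, mul_one] at hfatou
  have : liminf (fun k => ∫⁻ b, f k b ∂(B : Measure DetStrategy)) atTop ≤ ENNReal.ofReal t :=
    liminf_le_of_le (by isBoundedDefault) fun c hc => by
      obtain ⟨k, hk⟩ := hc.exists
      exact hk.trans (hbd k)
  exact absurd (hfatou.trans this) (by simp)

end RandStrategy

theorem rho_pos {s : ℝ} (hs : 0 < s) : 0 < rho s :=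
  div_pos (Real.exp_pos s) hs

/-- The lower bound on the cost of the prediction, with a free parameter `c`. -/
theorem IsRobust.cost_one_lower_bound {B : RandStrategy} {s c : ℝ} (hs : 0 < s) (hs1 : s < 1)
    (hc0 : 0 ≤ c) (hc1 : c ≤ 1) (hB : IsRobust B (rho s)) :
    Real.exp s * (1 - Real.exp (-(s * c))) ≤ s * (1 - s * (1 - c)) * (B.cost 1).toReal := by
  have hρ := rho_pos hs
  have hfin : ∀ T, 0 < T → B.cost T ≠ ∞ := fun T hT =>
    ne_top_of_le_ne_top ENNReal.ofReal_ne_top (hB T hT)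
  have hC := fun T y (hT : 0 < T) (hy : 0 < y) => RandStrategy.meanSum_add_le_cost hfin hT hy
  have hF := fun T y (hT : 0 < T) (hy : 0 < y) => RandStrategy.meanSum_add_le_meanSum hfin hT hy
  have hCρ : ∀ T, 0 < T → (B.cost T).toReal ≤ rho s * T := fun T hT =>
    ENNReal.toReal_le_of_le_ofReal (by positivity) (hB T hT)
  have hb := bddAbove_envelope hC (RandStrategy.exists_le_meanCount hfin)
  have hone : B.meanCount 1 = 0 := by simp [RandStrategy.meanCount]
  have key := value_one_lower_bound hs hs1 hc0 hc1 (envelope_continuous hb)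
    (envelope_nonneg hb (fun y _ => integral_nonneg fun _ => ENNReal.toReal_nonneg)
      fun y hy hy1 => RandStrategy.meanCount_nonpos hfin hy hy1)
    (fun t u htu => by
      convert envelope_step hρ hb hF hC hCρ htu using 3
      rw [rho, Real.exp_neg]
      field_simp)
    (fun u hu => by
      have := envelope_slope hb hF one_pos hone.le hu
      linarith)
  refine key.trans (mul_le_mul_of_nonneg_left (envelope_le fun y hy => ?_) ?_)
  · have := hC 1 y one_pos hy
    rwa [hone, add_zero] at this
  · have : s * (1 - c) ≤ 1 := by nlinarith
    exact mul_nonneg hs.le (by linarith)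

/-! ### Extending a function to the left by averages -/

theorem lintegral_Ioc_exp {s : ℝ} {a b : ℝ} (hs : 0 < s) (hab : a ≤ b) :
    ∫⁻ u in Ioc a b, ENNReal.ofReal (s * Real.exp (s * u))
      = ENNReal.ofReal (Real.exp (s * b) - Real.exp (s * a)) := by
  rw [← ofReal_integral_eq_lintegral_ofReal, ← intervalIntegral.integral_of_le hab,
    intervalIntegral.integral_eq_sub_of_hasDerivAt (f := fun u => Real.exp (s * u))]
  · intro u _
    exact (((hasDerivAt_id u).const_mul s).exp).congr_deriv (by simp [mul_comm])
  · exact Continuous.intervalIntegrable (by fun_prop) _ _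
  · exact (Continuous.integrableOn_Icc (by fun_prop)).mono_set Ioc_subset_Icc_self
  · exact ae_of_all _ fun u => by positivity

theorem measurable_lintegral_Ioc_add_one {Z : ℝ → ℝ≥0∞} (hZ : Measurable Z) :
    Measurable fun t : ℝ => ∫⁻ v in Ioc t (t + 1), Z v := by
  have h : ∀ t : ℝ, ∫⁻ v in Ioc t (t + 1), Z v
      = ∫⁻ v, if t < v ∧ v ≤ t + 1 then Z v else 0 := fun t => by
    rw [← lintegral_indicator measurableSet_Ioc]
    simp only [indicator_apply, mem_Ioc]
  simp only [h]
  refine Measurable.lintegral_prod_right' (f := fun p : ℝ × ℝ =>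
    if p.1 < p.2 ∧ p.2 ≤ p.1 + 1 then Z p.2 else 0) ?_
  refine Measurable.ite ?_ (hZ.comp measurable_snd) measurable_const
  exact (measurableSet_lt measurable_fst measurable_snd).inter
    (measurableSet_le measurable_snd (measurable_fst.add_const 1))

/-- A function that equals `s` times its integral over the following unit interval satisfies an
integrated form of the equation `x' (t) = s e⁻ˢ x (t + 1)` for `x t = eˢᵗ Z t`, which follows by
exchanging the order of integration. The first summand is kept on both sides because the identity
is one between extended nonnegative numbers. -/
theorem lintegral_exp_mul_eq_of_average {s t : ℝ} (hs : 0 < s) {Z : ℝ → ℝ≥0∞} (hZ : Measurable Z)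
    (hfix : ∀ u ≤ t, Z u = ENNReal.ofReal s * ∫⁻ v in Ioc u (u + 1), Z v) :
    (∫⁻ u in Iic t, ENNReal.ofReal (Real.exp (s * u)) * Z u)
        + ENNReal.ofReal (Real.exp (-s)) *
          ∫⁻ v in Iic (t + 1), ENNReal.ofReal (Real.exp (s * v)) * Z v
      = (∫⁻ u in Iic t, ENNReal.ofReal (Real.exp (s * u)) * Z u)
        + ENNReal.ofReal (Real.exp (s * t)) * ∫⁻ v in Ioc t (t + 1), Z v := by
  set K : ℝ → ℝ → ℝ≥0∞ := fun u v =>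
    if u < v ∧ v ≤ u + 1 then ENNReal.ofReal (s * Real.exp (s * u)) * Z v else 0 with hK
  have hKm : Measurable (Function.uncurry K) := by
    refine Measurable.ite ?_ (Measurable.mul ?_ (hZ.comp measurable_snd)) measurable_const
    · exact (measurableSet_lt measurable_fst measurable_snd).inter
        (measurableSet_le measurable_snd (measurable_fst.add_const 1))
    · have : Measurable fun u : ℝ => ENNReal.ofReal (s * Real.exp (s * u)) := by fun_prop
      exact this.comp measurable_fst
  have hleft : (∫⁻ u in Iic t, ENNReal.ofReal (Real.exp (s * u)) * Z u)
      = ∫⁻ u in Iic t, ∫⁻ v in Iic (t + 1), K u v := by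
    refine setLIntegral_congr_fun measurableSet_Iic fun u hu => ?_
    have hu : u ≤ t := hu
    have h1 : ∫⁻ v in Iic (t + 1), K u v
        = ∫⁻ v in Ioc u (u + 1), ENNReal.ofReal (s * Real.exp (s * u)) * Z v := by
      rw [← lintegral_indicator measurableSet_Iic, ← lintegral_indicator measurableSet_Ioc]
      refine lintegral_congr fun v => ?_
      by_cases h : u < v ∧ v ≤ u + 1
      · rw [indicator_of_mem (show v ∈ Iic (t + 1) from by simp only [mem_Iic]; linarith),
          indicator_of_mem (show v ∈ Ioc u (u + 1) from h), hK]
        simp only [if_pos h]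
      · rw [indicator_of_notMem (show v ∉ Ioc u (u + 1) from h), hK]
        simp [if_neg h, indicator]
    rw [h1, lintegral_const_mul _ hZ, hfix u hu, ← mul_assoc,
      ENNReal.ofReal_mul hs.le, mul_comm (ENNReal.ofReal s)]
  have hinner : ∀ v ∈ Iic (t + 1), ∫⁻ u in Iic t, K u v
      = ENNReal.ofReal (Real.exp (s * min v t) - Real.exp (s * (v - 1))) * Z v := by
    intro v hv
    have hv : v ≤ t + 1 := hv
    have h1 : ∫⁻ u in Iic t, K u v
        = ∫⁻ u in Iic t ∩ Ico (v - 1) v, ENNReal.ofReal (s * Real.exp (s * u)) * Z v := by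
      rw [← lintegral_indicator measurableSet_Iic,
        ← lintegral_indicator (measurableSet_Iic.inter measurableSet_Ico)]
      refine lintegral_congr fun u => ?_
      have hiff : u ∈ Ico (v - 1) v ↔ u < v ∧ v ≤ u + 1 := by
        simp only [mem_Ico]
        constructor <;> rintro ⟨h1, h2⟩ <;> constructor <;> linarith
      rw [← indicator_indicator]
      simp only [indicator_apply, hiff, hK]
    have h2 : (Iic t ∩ Ico (v - 1) v : Set ℝ) =ᵐ[volume] Ioc (v - 1) (min v t) := by
      rcases le_or_gt v t with h | h
      · rw [min_eq_left h, inter_eq_right.2 fun u hu => hu.2.le.trans h]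
        exact Ico_ae_eq_Ioc
      · have : Iic t ∩ Ico (v - 1) v = Icc (v - 1) t := by
          ext u
          simp only [mem_inter_iff, mem_Iic, mem_Ico, mem_Icc]
          constructor
          · rintro ⟨h1, h2, -⟩; exact ⟨h2, h1⟩
          · rintro ⟨h1, h2⟩; exact ⟨h2, h1, by linarith⟩
        rw [min_eq_right h.le, this]
        exact Ioc_ae_eq_Icc.symm
    rw [h1, lintegral_mul_const _ (by fun_prop), setLIntegral_congr h2,
      lintegral_Ioc_exp hs (le_min (by linarith) (by linarith))]
  have hE : ∀ v ∈ Iic (t + 1), (∫⁻ u in Iic t, K u v)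
      + ENNReal.ofReal (Real.exp (-s)) * (ENNReal.ofReal (Real.exp (s * v)) * Z v)
      = ENNReal.ofReal (Real.exp (s * min v t)) * Z v := by
    intro v hv
    have hv' : v ≤ t + 1 := hv
    rw [hinner v hv, ← mul_assoc, ← add_mul, ← ENNReal.ofReal_mul (Real.exp_pos _).le,
      ← ENNReal.ofReal_add _ (by positivity), ← Real.exp_add]
    · congr 2
      have : -s + s * v = s * (v - 1) := by ring
      rw [this]; ring
    · rw [sub_nonneg, Real.exp_le_exp]
      exact mul_le_mul_of_nonneg_left (le_min (by linarith) (by linarith)) hs.le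
  have hm1 : Measurable fun v : ℝ => ENNReal.ofReal (Real.exp (s * v)) * Z v :=
    Measurable.mul (by fun_prop) hZ
  calc _ = (∫⁻ v in Iic (t + 1), ∫⁻ u in Iic t, K u v) + ∫⁻ v in Iic (t + 1),
        ENNReal.ofReal (Real.exp (-s)) * (ENNReal.ofReal (Real.exp (s * v)) * Z v) := by
        rw [lintegral_const_mul _ hm1, ← lintegral_lintegral_swap hKm.aemeasurable, ← hleft]
    _ = ∫⁻ v in Iic (t + 1), ENNReal.ofReal (Real.exp (s * min v t)) * Z v := by
        rw [← lintegral_add_right _ (hm1.const_mul _)]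
        exact setLIntegral_congr_fun measurableSet_Iic hE
    _ = _ := by
        rw [← Iic_union_Ioc_eq_Iic (by linarith : t ≤ t + 1),
          lintegral_union measurableSet_Ioc (by
            rw [Set.disjoint_left]
            intro u hu hu'
            exact absurd hu'.1 (not_lt.2 hu))]
        congr 1
        · refine setLIntegral_congr_fun measurableSet_Iic fun u hu => ?_
          rw [min_eq_left hu]
        · rw [← lintegral_const_mul _ hZ]
          refine setLIntegral_congr_fun measurableSet_Ioc fun u hu => ?_
          rw [min_eq_right hu.1.le]

/-- Approximations, increasing in `k`, of the function that equals `exp (-s min (t, c))` for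
`t > 0`, and `s` times its integral over `(t, t + 1]` for `t ≤ 0`. -/
noncomputable def averageSeq (s c : ℝ) : ℕ → ℝ → ℝ≥0∞
  | 0, t => if 0 < t then ENNReal.ofReal (Real.exp (-(s * min t c))) else 0
  | k + 1, t => if 0 < t then ENNReal.ofReal (Real.exp (-(s * min t c)))
      else ENNReal.ofReal s * ∫⁻ v in Ioc t (t + 1), averageSeq s c k v

/-- The function that equals `exp (-s min (t, c))` for `t > 0`, and `s` times its integral over
`(t, t + 1]` for `t ≤ 0`. -/
noncomputable def averageExt (s c t : ℝ) : ℝ≥0∞ :=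
  ⨆ k, averageSeq s c k t

section AverageExt

variable {s c : ℝ}

theorem measurable_averageSeq (s c : ℝ) (k : ℕ) : Measurable (averageSeq s c k) := by
  have h : Measurable fun t : ℝ => ENNReal.ofReal (Real.exp (-(s * min t c))) := by fun_prop
  induction k with
  | zero => exact Measurable.ite measurableSet_Ioi h measurable_const
  | succ k ih =>
    exact Measurable.ite measurableSet_Ioi h ((measurable_lintegral_Ioc_add_one ih).const_mul _)

theorem measurable_averageExt (s c : ℝ) : Measurable (averageExt s c) :=
  Measurable.iSup (measurable_averageSeq s c)

theorem averageSeq_monotone (s c : ℝ) : Monotone (averageSeq s c) := by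
  refine monotone_nat_of_le_succ fun k => ?_
  induction k with
  | zero =>
    intro t
    by_cases h : 0 < t <;> simp [averageSeq, h]
  | succ k ih =>
    intro t
    rw [averageSeq, averageSeq]
    by_cases h : 0 < t
    · simp [h]
    · simp only [h, if_false]
      exact mul_le_mul_right (lintegral_mono ih) _

theorem averageSeq_le_one (hs : 0 < s) (hs1 : s ≤ 1) (hc : 0 ≤ c) (k : ℕ) (t : ℝ) :
    averageSeq s c k t ≤ 1 := by
  have h0 : ∀ t, 0 < t → ENNReal.ofReal (Real.exp (-(s * min t c))) ≤ 1 := fun t ht => by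
    rw [ENNReal.ofReal_le_one, Real.exp_le_one_iff]
    have := mul_nonneg hs.le (le_min ht.le hc)
    linarith
  induction k generalizing t with
  | zero =>
    rw [averageSeq]
    split_ifs with h
    · exact h0 t h
    · exact zero_le_one
  | succ k ih =>
    rw [averageSeq]
    split_ifs with h
    · exact h0 t h
    · calc _ ≤ 1 * ∫⁻ v in Ioc t (t + 1), 1 :=
          mul_le_mul' (by simpa using hs1) (lintegral_mono fun v => ih v)
        _ = 1 := by simp

theorem averageExt_le_one (hs : 0 < s) (hs1 : s ≤ 1) (hc : 0 ≤ c) (t : ℝ) :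
    averageExt s c t ≤ 1 :=
  iSup_le fun k => averageSeq_le_one hs hs1 hc k t

theorem averageExt_of_pos {t : ℝ} (ht : 0 < t) :
    averageExt s c t = ENNReal.ofReal (Real.exp (-(s * min t c))) := by
  have h : ∀ k, averageSeq s c k t = ENNReal.ofReal (Real.exp (-(s * min t c))) := by
    intro k
    cases k <;> rw [averageSeq, if_pos ht]
  simp [averageExt, h]

theorem averageExt_of_nonpos {t : ℝ} (ht : t ≤ 0) :
    averageExt s c t = ENNReal.ofReal s * ∫⁻ v in Ioc t (t + 1), averageExt s c v := by
  unfold averageExt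
  have hmono : Monotone fun k => averageSeq s c k t := fun _ _ h => averageSeq_monotone s c h t
  rw [lintegral_iSup (measurable_averageSeq s c) (averageSeq_monotone s c), ENNReal.mul_iSup,
    ← hmono.iSup_nat_add 1]
  simp only [averageSeq, if_neg ht.not_gt]

theorem averageExt_pos (hs : 0 < s) (t : ℝ) : 0 < averageExt s c t := by
  suffices h : ∀ n : ℕ, ∀ t : ℝ, -(n : ℝ) < t → 0 < averageExt s c t by
    obtain ⟨n, hn⟩ := exists_nat_gt (-t)
    exact h n t (by linarith)
  intro n
  induction n with
  | zero =>
    intro t ht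
    rw [averageExt_of_pos (by simpa using ht)]
    simpa using Real.exp_pos _
  | succ n ih =>
    intro t ht
    push_cast at ht
    rcases lt_or_ge 0 t with h | h
    · rw [averageExt_of_pos h]
      simpa using Real.exp_pos _
    · rw [averageExt_of_nonpos h]
      refine ENNReal.mul_pos (by simpa using hs) ?_
      have hpos : 0 < ∫⁻ v in Ioc (max t (-n)) (t + 1), averageExt s c v := by
        rw [setLIntegral_pos_iff (measurable_averageExt s c)]
        have : Function.support (averageExt s c) ∩ Ioc (max t (-(n : ℝ))) (t + 1)
            = Ioc (max t (-(n : ℝ))) (t + 1) :=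
          inter_eq_right.2 fun v hv => (ih v ((le_max_right _ _).trans_lt hv.1)).ne'
        rw [this, Real.volume_Ioc, ENNReal.ofReal_pos, sub_pos, max_lt_iff]
        constructor <;> linarith
      exact (hpos.trans_le (lintegral_mono_set (Ioc_subset_Ioc_left (le_max_left _ _)))).ne'

end AverageExt

/-! ### The optimal strategy -/

/-- The bids of the optimal strategy, sorted: they are `profile s c (n + U)` for `n : ℤ` and a
random shift `U`. The profile is `1` on `(0, c]`, then grows exponentially at rate `s`, and
it solves `x' (t) = x (t + 1) / ρ` for `t < 0`. -/
noncomputable def profile (s c t : ℝ) : ℝ :=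
  Real.exp (s * t) * (averageExt s c t).toReal

/-- The expected sum of all bids `profile s c (n + U)` with `n + U ≤ t`. -/
noncomputable def cumProfile (s c t : ℝ) : ℝ :=
  ∫ u in Iic t, profile s c u

section Profile

variable {s c : ℝ}

theorem measurable_profile (s c : ℝ) : Measurable (profile s c) :=
  Measurable.mul (by fun_prop) (measurable_averageExt s c).ennreal_toReal

theorem profile_of_pos {t : ℝ} (ht : 0 < t) :
    profile s c t = Real.exp (s * (t - min t c)) := by
  rw [profile, averageExt_of_pos ht, ENNReal.toReal_ofReal (Real.exp_pos _).le, ← Real.exp_add]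
  congr 1; ring

theorem one_le_profile (hs : 0 < s) {t : ℝ} (ht : 0 < t) : 1 ≤ profile s c t := by
  rw [profile_of_pos ht, Real.one_le_exp_iff]
  exact mul_nonneg hs.le (sub_nonneg.2 (min_le_left _ _))

theorem profile_of_le (ht : 0 < t) (hct : c ≤ t) : profile s c t = Real.exp (s * (t - c)) := by
  rw [profile_of_pos ht, min_eq_right hct]

variable (hs : 0 < s) (hs1 : s ≤ 1) (hc : 0 ≤ c)
include hs hs1 hc

theorem averageExt_ne_top (t : ℝ) : averageExt s c t ≠ ∞ :=
  ne_top_of_le_ne_top ENNReal.one_ne_top (averageExt_le_one hs hs1 hc t)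

theorem ofReal_profile (t : ℝ) :
    ENNReal.ofReal (profile s c t) = ENNReal.ofReal (Real.exp (s * t)) * averageExt s c t := by
  rw [profile, ENNReal.ofReal_mul (Real.exp_pos _).le,
    ENNReal.ofReal_toReal (averageExt_ne_top hs hs1 hc t)]

theorem profile_pos (t : ℝ) : 0 < profile s c t :=
  mul_pos (Real.exp_pos _)
    (ENNReal.toReal_pos (averageExt_pos hs t).ne' (averageExt_ne_top hs hs1 hc t))

theorem profile_le_exp (t : ℝ) : profile s c t ≤ Real.exp (s * t) :=
  mul_le_of_le_one_right (Real.exp_pos _).le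
    (ENNReal.toReal_le_of_le_ofReal zero_le_one (by simpa using averageExt_le_one hs hs1 hc t))

theorem integrableOn_profile (t : ℝ) : IntegrableOn (profile s c) (Iic t) := by
  refine (integrableOn_exp_mul_Iic hs t).mono' (measurable_profile s c).aestronglyMeasurable
    (ae_of_all _ fun u => ?_)
  rw [Real.norm_of_nonneg (profile_pos hs hs1 hc u).le]
  exact profile_le_exp hs hs1 hc u

theorem intervalIntegrable_profile (a b : ℝ) : IntervalIntegrable (profile s c) volume a b :=
  ((integrableOn_profile hs hs1 hc (max a b)).mono_set fun _ hu => hu.2).intervalIntegrable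

theorem ofReal_cumProfile (t : ℝ) :
    ENNReal.ofReal (cumProfile s c t) = ∫⁻ u in Iic t, ENNReal.ofReal (profile s c u) :=
  ofReal_integral_eq_lintegral_ofReal (integrableOn_profile hs hs1 hc t)
    (ae_of_all _ fun u => (profile_pos hs hs1 hc u).le)

theorem cumProfile_nonneg (t : ℝ) : 0 ≤ cumProfile s c t :=
  integral_nonneg fun u => (profile_pos hs hs1 hc u).le

theorem cumProfile_le_exp (t : ℝ) : cumProfile s c t ≤ Real.exp (s * t) / s := by
  rw [← integral_exp_mul_Iic hs t]
  exact integral_mono (integrableOn_profile hs hs1 hc t) (integrableOn_exp_mul_Iic hs t)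
    (profile_le_exp hs hs1 hc)

theorem cumProfile_sub (a b : ℝ) :
    cumProfile s c b - cumProfile s c a = ∫ u in a..b, profile s c u :=
  intervalIntegral.integral_Iic_sub_Iic (integrableOn_profile hs hs1 hc a)
    (integrableOn_profile hs hs1 hc b)

theorem cumProfile_strictMono : StrictMono (cumProfile s c) := by
  intro a b hab
  rw [← sub_pos, cumProfile_sub hs hs1 hc]
  exact intervalIntegral.intervalIntegral_pos_of_pos (intervalIntegrable_profile hs hs1 hc a b)
    (profile_pos hs hs1 hc) hab

theorem cumProfile_continuous : Continuous (cumProfile s c) := by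
  have h : cumProfile s c = fun t => cumProfile s c 0 + ∫ u in (0 : ℝ)..t, profile s c u := by
    funext t
    rw [← cumProfile_sub hs hs1 hc]; ring
  rw [h]
  exact continuous_const.add
    (intervalIntegral.continuous_primitive (intervalIntegrable_profile hs hs1 hc) 0)

omit hs1 hc in
theorem profile_eq_mul_lintegral {t : ℝ} (ht : t ≤ 0) :
    profile s c t
      = Real.exp (s * t) * (s * (∫⁻ v in Ioc t (t + 1), averageExt s c v).toReal) := by
  rw [profile, averageExt_of_nonpos ht, ENNReal.toReal_mul, ENNReal.toReal_ofReal hs.le]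

/-- For a target `profile s c t` below the prediction, the robustness constraint is tight. -/
theorem rho_mul_profile {t : ℝ} (ht : t ≤ 0) :
    rho s * profile s c t = cumProfile s c (t + 1) := by
  have h := lintegral_exp_mul_eq_of_average hs (measurable_averageExt s c) (t := t)
    fun u hu => averageExt_of_nonpos (hu.trans ht)
  simp only [← ofReal_profile hs hs1 hc, ← ofReal_cumProfile hs hs1 hc] at h
  have h := congrArg ENNReal.toReal ((ENNReal.add_right_inj ENNReal.ofReal_ne_top).1 h)
  rw [ENNReal.toReal_mul, ENNReal.toReal_mul, ENNReal.toReal_ofReal (Real.exp_pos _).le,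
    ENNReal.toReal_ofReal (Real.exp_pos _).le,
    ENNReal.toReal_ofReal (cumProfile_nonneg hs hs1 hc _)] at h
  rw [profile_eq_mul_lintegral hs ht, rho]
  have he : Real.exp s * Real.exp (-s) = 1 := by rw [← Real.exp_add]; simp
  calc _ = Real.exp s * (Real.exp (s * t)
          * (∫⁻ v in Ioc t (t + 1), averageExt s c v).toReal) := by field_simp
    _ = (Real.exp s * Real.exp (-s)) * cumProfile s c (t + 1) := by rw [← h]; ring
    _ = _ := by rw [he, one_mul]

theorem cumProfile_one (hc1 : c ≤ 1) :
    cumProfile s c 1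
      = Real.exp s * (1 - Real.exp (-(s * c)) + s * (1 - c) * Real.exp (-(s * c))) / s := by
  have h := rho_mul_profile hs hs1 hc le_rfl
  rw [zero_add] at h
  have hcont : Continuous fun v : ℝ => Real.exp (-(s * min v c)) := by fun_prop
  have hint : (∫⁻ v in Ioc (0 : ℝ) 1, averageExt s c v).toReal
      = ∫ v in (0 : ℝ)..1, Real.exp (-(s * min v c)) := by
    rw [setLIntegral_congr_fun measurableSet_Ioc fun v hv => averageExt_of_pos hv.1,
      intervalIntegral.integral_of_le zero_le_one, ← ofReal_integral_eq_lintegral_ofReal,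
      ENNReal.toReal_ofReal]
    · exact integral_nonneg fun v => (Real.exp_pos _).le
    · exact hcont.integrableOn_Icc.mono_set Ioc_subset_Icc_self
    · exact ae_of_all _ fun v => (Real.exp_pos _).le
  have e1 : ∫ v in (0 : ℝ)..c, Real.exp (-(s * min v c)) = (1 - Real.exp (-(s * c))) / s := by
    have : ∫ v in (0 : ℝ)..c, Real.exp (-(s * min v c)) = ∫ v in (0 : ℝ)..c, Real.exp (-(s * v)) := by
      refine intervalIntegral.integral_congr fun v hv => ?_
      rw [uIcc_of_le hc] at hv
      simp only [min_eq_left hv.2]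
    rw [this, intervalIntegral.integral_eq_sub_of_hasDerivAt
      (f := fun v => -Real.exp (-(s * v)) / s)]
    · simp; ring
    · intro v _
      refine ((((hasDerivAt_id v).const_mul s).neg.exp).neg.div_const s).congr_deriv ?_
      simp; field_simp
    · exact Continuous.intervalIntegrable (by fun_prop) _ _
  have e2 : ∫ v in c..1, Real.exp (-(s * min v c)) = (1 - c) * Real.exp (-(s * c)) := by
    have : ∫ v in c..1, Real.exp (-(s * min v c)) = ∫ v in c..1, Real.exp (-(s * c)) := by
      refine intervalIntegral.integral_congr fun v hv => ?_
      rw [uIcc_of_le hc1] at hv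
      simp only [min_eq_right hv.1]
    rw [this]; simp
  rw [← intervalIntegral.integral_add_adjacent_intervals (hcont.intervalIntegrable 0 c)
    (hcont.intervalIntegrable c 1), e1, e2] at hint
  rw [← h, profile_eq_mul_lintegral hs le_rfl, zero_add, hint, rho]
  simp
  field_simp

/-- The right-hand side is `ρ` minus the expected sum of the bids at times in `(1, c + 1]`, so that
this is the robustness constraint for targets just above `1`, which are first reached after
time `c`. -/
theorem cumProfile_one_le (hc1 : c ≤ 1) (hcs : Real.exp (s * c) + s * (1 - c) ≤ 2) :
    cumProfile s c 1 ≤ Real.exp (s * (1 - c)) / s := by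
  rw [cumProfile_one hs hs1 hc hc1]
  have he : Real.exp (s * (1 - c)) = Real.exp s * Real.exp (-(s * c)) := by
    rw [← Real.exp_add]; congr 1; ring
  have h1 : Real.exp (-(s * c)) * Real.exp (s * c) = 1 := by rw [← Real.exp_add]; simp
  rw [he]
  refine div_le_div_of_nonneg_right (mul_le_mul_of_nonneg_left ?_ (Real.exp_pos _).le) hs.le
  nlinarith [mul_le_mul_of_nonneg_left hcs (Real.exp_pos (-(s * c))).le]

theorem profile_le_of_nonpos (hc1 : c ≤ 1) (hcs : Real.exp (s * c) + s * (1 - c) ≤ 2) {t : ℝ}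
    (ht : t ≤ 0) : profile s c t ≤ Real.exp (-(s * c)) := by
  have h1 := rho_mul_profile hs hs1 hc ht
  have h2 := (cumProfile_strictMono hs hs1 hc).monotone (by linarith : t + 1 ≤ 1)
  have h3 := cumProfile_one_le hs hs1 hc hc1 hcs
  have he : Real.exp (s * (1 - c)) / s = rho s * Real.exp (-(s * c)) := by
    rw [rho, div_mul_eq_mul_div, ← Real.exp_add]; congr 2; ring
  rw [he] at h3
  exact le_of_mul_le_mul_left (by linarith) (rho_pos hs)

theorem profile_monotone (hc1 : c ≤ 1) (hcs : Real.exp (s * c) + s * (1 - c) ≤ 2) :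
    Monotone (profile s c) := by
  intro t u htu
  rcases le_or_gt u 0 with hu | hu
  · refine le_of_mul_le_mul_left ?_ (rho_pos hs)
    rw [rho_mul_profile hs hs1 hc (htu.trans hu), rho_mul_profile hs hs1 hc hu]
    exact (cumProfile_strictMono hs hs1 hc).monotone (by linarith)
  · rcases le_or_gt t 0 with ht | ht
    · refine (profile_le_of_nonpos hs hs1 hc hc1 hcs ht).trans (le_trans ?_ (one_le_profile hs hu))
      rw [Real.exp_le_one_iff]
      have := mul_nonneg hs.le hc
      linarith
    · rw [profile_of_pos ht, profile_of_pos hu, Real.exp_le_exp]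
      refine mul_le_mul_of_nonneg_left ?_ hs.le
      rcases le_total t c with h | h
      · rw [min_eq_left h, sub_self]
        exact sub_nonneg.2 (min_le_left _ _)
      · rw [min_eq_right h, min_eq_right (h.trans htu)]
        linarith

theorem profile_lt_add_one (hc1 : c ≤ 1) (hcs : Real.exp (s * c) + s * (1 - c) ≤ 2) (t : ℝ) :
    profile s c t < profile s c (t + 1) := by
  rcases lt_trichotomy (t + 1) 1 with h | h | h
  · have ht : t < 0 := by linarith
    rcases le_or_gt (t + 1) 0 with h' | h'
    · refine lt_of_mul_lt_mul_left ?_ (rho_pos hs).le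
      rw [rho_mul_profile hs hs1 hc ht.le, rho_mul_profile hs hs1 hc h']
      exact cumProfile_strictMono hs hs1 hc (by linarith)
    · refine lt_of_lt_of_le ?_ (one_le_profile hs h')
      refine lt_of_lt_of_le ?_ ((profile_le_of_nonpos hs hs1 hc hc1 hcs le_rfl).trans ?_)
      · refine lt_of_mul_lt_mul_left ?_ (rho_pos hs).le
        rw [rho_mul_profile hs hs1 hc ht.le, rho_mul_profile hs hs1 hc le_rfl]
        exact cumProfile_strictMono hs hs1 hc (by linarith)
      · rw [Real.exp_le_one_iff]
        have := mul_nonneg hs.le hc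
        linarith
  · rw [h, profile_of_le one_pos hc1]
    refine (profile_le_of_nonpos hs hs1 hc hc1 hcs (by linarith)).trans_lt ?_
    rw [Real.exp_lt_exp]
    linarith
  · have ht : 0 < t := by linarith
    rw [profile_of_pos ht, profile_of_le (by linarith) (by linarith : c ≤ t + 1), Real.exp_lt_exp]
    refine mul_lt_mul_of_pos_left ?_ hs
    rcases le_total t c with h' | h'
    · rw [min_eq_left h']; linarith
    · rw [min_eq_right h']; linarith

/-- Every target `T` is reached by all bids at times after some `t` such that the expected sum of the
bids up to time `t + 1` is at most `ρ T`. -/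
theorem exists_time (hc1 : c ≤ 1) (hcs : Real.exp (s * c) + s * (1 - c) ≤ 2) {T : ℝ} (hT : 0 < T) :
    ∃ t, (∀ u, t < u → T ≤ profile s c u) ∧ cumProfile s c (t + 1) ≤ rho s * T := by
  have hρ := rho_pos hs
  rcases le_or_gt (cumProfile s c 1) (rho s * T) with h | h
  · rcases le_or_gt T 1 with h1 | h1
    · exact ⟨0, fun u hu => h1.trans (one_le_profile hs hu), by rwa [zero_add]⟩
    · have hlog : 0 < Real.log T := Real.log_pos h1
      have hdiv : 0 < Real.log T / s := div_pos hlog hs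
      refine ⟨c + Real.log T / s, fun u hu => ?_, ?_⟩
      · rw [profile_of_le (by linarith) (by linarith)]
        calc T = Real.exp (s * (Real.log T / s)) := by
              rw [mul_div_cancel₀ _ hs.ne', Real.exp_log hT]
          _ ≤ _ := Real.exp_le_exp.2 (mul_le_mul_of_nonneg_left (by linarith) hs.le)
      · set t := c + Real.log T / s with ht
        have h2 := cumProfile_sub hs hs1 hc 1 (t + 1)
        have h3 : ∫ u in (1 : ℝ)..(t + 1), profile s c u
            = ∫ u in (1 : ℝ)..(t + 1), Real.exp (s * (u - c)) := by
          refine intervalIntegral.integral_congr fun u hu => ?_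
          rw [uIcc_of_le (by linarith)] at hu
          exact profile_of_le (by linarith [hu.1]) (hc1.trans hu.1)
        have h4 : ∫ u in (1 : ℝ)..(t + 1), Real.exp (s * (u - c))
            = Real.exp (s * (t + 1 - c)) / s - Real.exp (s * (1 - c)) / s := by
          refine intervalIntegral.integral_eq_sub_of_hasDerivAt
            (f := fun u => Real.exp (s * (u - c)) / s) (fun u _ => ?_)
            (Continuous.intervalIntegrable (by fun_prop) _ _)
          refine (((((hasDerivAt_id u).sub_const c).const_mul s).exp).div_const s).congr_deriv ?_
          simp; field_simp
        have h5 : Real.exp (s * (t + 1 - c)) / s = rho s * T := by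
          have : s * (t + 1 - c) = s + Real.log T := by rw [ht]; field_simp; ring
          rw [this, Real.exp_add, Real.exp_log hT, rho]; ring
        have h6 := cumProfile_one_le hs hs1 hc hc1 hcs
        linarith
  · obtain ⟨a, ha⟩ : ∃ a, cumProfile s c a < rho s * T := by
      have hlim : Tendsto (fun a : ℝ => Real.exp (s * a) / s) atBot (𝓝 (0 / s)) :=
        (Real.tendsto_exp_atBot.comp (tendsto_id.const_mul_atBot hs)).div_const s
      rw [zero_div] at hlim
      obtain ⟨a, ha⟩ := (hlim.eventually_lt_const (mul_pos hρ hT)).exists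
      exact ⟨a, (cumProfile_le_exp hs hs1 hc a).trans_lt ha⟩
    have ha1 : a ≤ 1 := by
      by_contra! h1
      linarith [cumProfile_strictMono hs hs1 hc h1]
    obtain ⟨t, ht, htT⟩ := intermediate_value_Icc ha1
      (cumProfile_continuous hs hs1 hc).continuousOn ⟨ha.le, h.le⟩
    refine ⟨t - 1, fun u hu => ?_, by rw [sub_add_cancel, htT]⟩
    refine le_trans ?_ (profile_monotone hs hs1 hc hc1 hcs hu.le)
    refine le_of_mul_le_mul_left ?_ hρ
    rw [rho_mul_profile hs hs1 hc (by linarith [ht.2]), sub_add_cancel, htT]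

end Profile

/-- The deterministic strategy with bids `profile s c (n + U)`. -/
noncomputable def shiftStrategy {s c : ℝ} (hs : 0 < s) (hs1 : s ≤ 1) (hc : 0 ≤ c) (hc1 : c ≤ 1)
    (hcs : Real.exp (s * c) + s * (1 - c) ≤ 2) (U : ℝ) : DetStrategy :=
  ⟨fun n => profile s c (n + U), by
    refine ⟨strictMono_int_of_lt_succ fun n => ?_, fun n => profile_pos hs hs1 hc _⟩
    have := profile_lt_add_one hs hs1 hc hc1 hcs (n + U)
    have e : (n : ℝ) + U + 1 = ((n + 1 : ℤ) : ℝ) + U := by push_cast; ring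
    rwa [e] at this⟩

theorem lintegral_eq_lintegral_tsum_shift {f : ℝ → ℝ≥0∞} (hf : Measurable f) :
    ∫⁻ u, f u = ∫⁻ U in Ioc (0 : ℝ) 1, ∑' n : ℤ, f (n + U) := by
  have hU := lintegral_iUnion (μ := volume) (s := fun n : ℤ => Ioc (n : ℝ) (n + 1))
    (fun _ => measurableSet_Ioc) (pairwise_disjoint_Ioc_intCast ℝ) f
  rw [iUnion_Ioc_intCast, setLIntegral_univ] at hU
  rw [lintegral_tsum (f := fun (n : ℤ) U => f (n + U))
    fun n => (hf.comp (measurable_const_add (n : ℝ))).aemeasurable, hU]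
  refine tsum_congr fun n => ?_
  rw [← lintegral_indicator measurableSet_Ioc, ← lintegral_indicator measurableSet_Ioc,
    ← lintegral_add_left_eq_self _ (n : ℝ)]
  refine lintegral_congr fun U => ?_
  have hiff : (n : ℝ) + U ∈ Ioc (n : ℝ) (n + 1) ↔ U ∈ Ioc (0 : ℝ) 1 := by
    simp [mem_Ioc]
  by_cases h : U ∈ Ioc (0 : ℝ) 1
  · rw [indicator_of_mem h, indicator_of_mem (hiff.2 h)]
  · rw [indicator_of_notMem h, indicator_of_notMem (mt hiff.1 h)]

section Strategy

variable {s c : ℝ} (hs : 0 < s) (hs1 : s ≤ 1) (hc : 0 ≤ c) (hc1 : c ≤ 1)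
  (hcs : Real.exp (s * c) + s * (1 - c) ≤ 2)

theorem measurable_shiftStrategy : Measurable (shiftStrategy hs hs1 hc hc1 hcs) :=
  Measurable.subtype_mk (measurable_pi_lambda (fun U (n : ℤ) => profile s c (n + U)) fun n =>
    (measurable_profile s c).comp (measurable_const_add (n : ℝ)))

/-- The bids `profile s c (n + U)` with `U` uniform on `(0, 1]`. -/
noncomputable def uniformShift : RandStrategy :=
  ⟨(volume.restrict (Ioc (0 : ℝ) 1)).map (shiftStrategy hs hs1 hc hc1 hcs),
    haveI : IsProbabilityMeasure (volume.restrict (Ioc (0 : ℝ) 1)) := ⟨by simp⟩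
    Measure.isProbabilityMeasure_map (measurable_shiftStrategy hs hs1 hc hc1 hcs).aemeasurable⟩

theorem cost_shiftStrategy_le {T t : ℝ} (hT : 0 < T) (ht : ∀ u, t < u → T ≤ profile s c u) (U : ℝ) :
    DetStrategy.cost (shiftStrategy hs hs1 hc hc1 hcs U) T
      ≤ ∑' n : ℤ, (Iic (t + 1)).indicator (fun u => ENNReal.ofReal (profile s c u)) (n + U) := by
  set m : ℤ := ⌊t - U⌋ + 1 with hm
  have hm1 : t < m + U := by
    have := Int.lt_floor_add_one (t - U)
    rw [hm]; push_cast; linarith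
  have hm2 : m + U ≤ t + 1 := by
    have := Int.floor_le (t - U)
    rw [hm]; push_cast; linarith
  obtain ⟨n, hn, hmin⟩ := Int.exists_least_of_bdd (P := fun k : ℤ => T ≤ profile s c (k + U))
    ⟨⌊Real.log T / s - U⌋, fun k hk => by
      have h1 := (Real.log_le_log hT (hk.trans (profile_le_exp hs hs1 hc _)))
      rw [Real.log_exp, ← div_le_iff₀' hs] at h1
      exact Int.floor_le_iff.2 (by linarith)⟩ ⟨m, ht _ hm1⟩
  have hleast : IsLeast {k : ℤ | T ≤ (shiftStrategy hs hs1 hc hc1 hcs U).1 k} n := ⟨hn, hmin⟩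
  rw [DetStrategy.cost_eq hleast, DetStrategy.partialSum]
  refine ENNReal.tsum_le_tsum fun k => ?_
  split_ifs with h
  · have hkm : k ≤ m := (Int.lt_add_one_iff.1 h).trans (hmin m (ht _ hm1))
    have : (k : ℝ) ≤ m := by exact_mod_cast hkm
    rw [indicator_of_mem (show (k : ℝ) + U ∈ Iic (t + 1) by simp only [mem_Iic]; linarith)]
    rfl
  · exact zero_le

theorem cost_uniformShift_le {T t : ℝ} (hT : 0 < T) (ht : ∀ u, t < u → T ≤ profile s c u) :
    RandStrategy.cost (uniformShift hs hs1 hc hc1 hcs) T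
      ≤ ENNReal.ofReal (cumProfile s c (t + 1)) := by
  have h1 : RandStrategy.cost (uniformShift hs hs1 hc hc1 hcs) T
      = ∫⁻ U in Ioc (0 : ℝ) 1, DetStrategy.cost (shiftStrategy hs hs1 hc hc1 hcs U) T :=
    lintegral_map (DetStrategy.measurable_cost T) (measurable_shiftStrategy hs hs1 hc hc1 hcs)
  rw [h1, ofReal_cumProfile hs hs1 hc, ← lintegral_indicator measurableSet_Iic,
    lintegral_eq_lintegral_tsum_shift
      ((measurable_profile s c).ennreal_ofReal.indicator measurableSet_Iic)]
  exact lintegral_mono fun U => cost_shiftStrategy_le hs hs1 hc hc1 hcs hT ht U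

theorem isRobust_uniformShift : IsRobust (uniformShift hs hs1 hc hc1 hcs) (rho s) := by
  intro T hT
  obtain ⟨t, ht, hle⟩ := exists_time hs hs1 hc hc1 hcs hT
  exact (cost_uniformShift_le hs hs1 hc hc1 hcs hT ht).trans (ENNReal.ofReal_le_ofReal hle)

theorem isConsistent_uniformShift :
    IsConsistent (uniformShift hs hs1 hc hc1 hcs) (cumProfile s c 1) := by
  have := cost_uniformShift_le hs hs1 hc hc1 hcs one_pos fun u hu => one_le_profile hs hu
  rwa [zero_add] at this

end Strategy

/-! ### The parameter of the trade-off curve -/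

theorem xi_strictMonoOn :
    StrictMonoOn (fun x : ℝ => x * (2 - Real.log x)) (Icc 1 (Real.exp 1)) := by
  refine strictMonoOn_of_deriv_pos (convex_Icc _ _) ?_ fun x hx => ?_
  · exact continuousOn_id.mul (continuousOn_const.sub
      (Real.continuousOn_log.mono fun x hx => (by linarith [hx.1] : (0 : ℝ) < x).ne'))
  · rw [interior_Icc] at hx
    have hx0 : 0 < x := by linarith [hx.1]
    have h : HasDerivAt (fun x : ℝ => x * (2 - Real.log x)) (1 * (2 - Real.log x) + x * (-x⁻¹)) x :=
      (hasDerivAt_id x).mul ((Real.hasDerivAt_log hx0.ne').const_sub 2)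
    have hlog : Real.log x < 1 := by
      rw [Real.log_lt_iff_lt_exp hx0]; exact hx.2
    rw [h.deriv, mul_neg, mul_inv_cancel₀ hx0.ne']
    linarith

theorem exists_isXi {s : ℝ} (hs : s ∈ Icc (Real.log 2) 1) : ∃ x, IsXi s x := by
  have h1e : (1 : ℝ) ≤ Real.exp 1 := Real.one_le_exp zero_le_one
  have hcont : ContinuousOn (fun x : ℝ => x * (2 - Real.log x)) (Icc 1 (Real.exp 1)) :=
    continuousOn_id.mul (continuousOn_const.sub
      (Real.continuousOn_log.mono fun x hx => (by linarith [hx.1] : (0 : ℝ) < x).ne'))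
  obtain ⟨x, hx, hxs⟩ := intermediate_value_Icc h1e hcont
    (show Real.exp s ∈ _ from ⟨by
      simpa using (Real.log_le_iff_le_exp two_pos).1 hs.1, by
      have := Real.exp_le_exp.2 hs.2
      simp only [Real.log_exp]; linarith⟩)
  exact ⟨x, hx, hxs⟩

theorem IsXi.unique {s x y : ℝ} (hx : IsXi s x) (hy : IsXi s y) : x = y :=
  xi_strictMonoOn.injOn hx.1 hy.1 (hx.2.trans hy.2.symm)

/-- A parameter `c` for which the lower bound and the cost of `uniformShift` agree,
`χ(s)` being their common value. In the first case `c = 1`; in the second one,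
`c = 1 - log ξ / s`. -/
theorem exists_parameter {ξ : ℝ → ℝ} (hξ : ∀ s ∈ Icc (Real.log 2) 1, IsXi s (ξ s)) {s : ℝ}
    (hs : 0 < s) (hs1 : s ≤ 1) :
    ∃ c, 0 ≤ c ∧ c ≤ 1 ∧ (s < 1 → 0 < c) ∧ Real.exp (s * c) + s * (1 - c) ≤ 2 ∧
      chi ξ s
        = Real.exp s * (1 - Real.exp (-(s * c)) + s * (1 - c) * Real.exp (-(s * c))) / s ∧
      s * (1 - s * (1 - c)) * chi ξ s = Real.exp s * (1 - Real.exp (-(s * c))) := by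
  by_cases h : s < Real.log 2
  · have he : Real.exp s * Real.exp (-s) = 1 := by rw [← Real.exp_add]; simp
    have h2 : Real.exp s < 2 := (Real.lt_log_iff_exp_lt two_pos).1 h
    refine ⟨1, zero_le_one, le_rfl, fun _ => one_pos, by simpa using h2.le, ?_, ?_⟩
    · rw [chi, if_pos h]
      congr 1
      simp only [mul_one, sub_self, mul_zero, zero_mul, add_zero]
      linarith
    · rw [chi, if_pos h]
      simp only [mul_one, sub_self, mul_zero, sub_zero]
      rw [mul_div_cancel₀ _ hs.ne']
      linarith
  · obtain ⟨⟨h1, h2⟩, h3⟩ := hξ s ⟨not_lt.1 h, hs1⟩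
    set x := ξ s with hx
    set l := Real.log x with hl
    have hx0 : 0 < x := by linarith
    have hl0 : 0 ≤ l := Real.log_nonneg h1
    have hl1 : l ≤ 1 := by rw [hl, Real.log_le_iff_le_exp hx0]; exact h2
    have hxl : Real.exp l = x := Real.exp_log hx0
    have hsl : Real.exp (s - l) = 2 - l := by
      rw [Real.exp_sub, hxl, ← h3]
      field_simp
    have hls : l ≤ s := by
      have : (1 : ℝ) ≤ Real.exp (s - l) := by rw [hsl]; linarith
      rw [Real.one_le_exp_iff] at this
      linarith
    have e1 : s * (1 - l / s) = s - l := by field_simp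
    have e2 : s * (1 - (1 - l / s)) = l := by field_simp; ring
    have e3 : Real.exp s * Real.exp (-(s - l)) = x := by
      rw [← Real.exp_add, ← hxl]; congr 1; ring
    refine ⟨1 - l / s, ?_, ?_, fun hs' => ?_, ?_, ?_, ?_⟩
    · rw [sub_nonneg, div_le_one hs]; exact hls
    · have := div_nonneg hl0 hs.le
      linarith
    · rw [sub_pos, div_lt_one hs]
      refine lt_of_le_of_ne hls fun heq => ?_
      rw [heq, sub_self, Real.exp_zero] at hsl
      linarith
    · rw [e1, e2, hsl]; linarith
    · rw [chi, if_neg h, e1, e2, ← hx]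
      congr 1
      have : Real.exp s = Real.exp l * Real.exp (s - l) := by rw [← Real.exp_add]; congr 1; ring
      rw [hxl, hsl] at this
      rw [mul_add, mul_sub, mul_one, ← mul_assoc, mul_right_comm, e3, this]
      ring
    · rw [chi, if_neg h, e1, e2, ← hx, mul_one_sub (Real.exp s), e3, ← h3]
      field_simp
      ring

theorem rho_strictAnti : StrictAntiOn rho (Ioc 0 1) := by
  intro s hs t ht hst
  have h : Real.exp (t - s) * (1 - (t - s)) < 1 := by
    have h1 := Real.add_one_lt_exp (show -(t - s) ≠ 0 by linarith)
    have h2 : Real.exp (t - s) * Real.exp (-(t - s)) = 1 := by rw [← Real.exp_add]; simp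
    calc _ < Real.exp (t - s) * Real.exp (-(t - s)) :=
          mul_lt_mul_of_pos_left (by linarith) (Real.exp_pos _)
      _ = 1 := h2
  have hts : 0 < t - s := by linarith
  have he : Real.exp t = Real.exp s * Real.exp (t - s) := by rw [← Real.exp_add]; congr 1; ring
  rw [rho, rho, div_lt_div_iff₀ ht.1 hs.1, he, mul_assoc]
  refine mul_lt_mul_of_pos_left ?_ (Real.exp_pos s)
  -- with `d = t - s`, the claim `eᵈ s < s + d` follows from `eᵈ (1 - d) < 1` and `s ≤ 1 - d`
  have h3 : s ≤ 1 - (t - s) := by linarith [ht.2]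
  have h4 : Real.exp (t - s) - 1 < Real.exp (t - s) * (t - s) := by linarith
  have h5 : Real.exp (t - s) * s * (1 - (t - s)) ≤ s := by nlinarith [hs.1]
  nlinarith [Real.exp_pos (t - s), hs.1]

theorem IsRobust.mono {B : RandStrategy} {ρ ρ' : ℝ} (h : IsRobust B ρ) (hle : ρ ≤ ρ') :
    IsRobust B ρ' := fun T hT =>
  (h T hT).trans (ENNReal.ofReal_le_ofReal (mul_le_mul_of_nonneg_right hle hT.le))

/-- The case `s = 1` of the lower bound: `s → 1` for fixed `c`, and then `c → 0`. -/
theorem IsRobust.exp_one_le_cost {B : RandStrategy} (hB : IsRobust B (rho 1)) :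
    Real.exp 1 ≤ (B.cost 1).toReal := by
  set C := (B.cost 1).toReal
  have h1 : ∀ c ∈ Ioc (0 : ℝ) 1, Real.exp 1 * (1 - Real.exp (-c)) ≤ c * C := by
    intro c hc
    have hl : Tendsto (fun s : ℝ => Real.exp s * (1 - Real.exp (-(s * c)))) (𝓝[<] 1)
        (𝓝 (Real.exp 1 * (1 - Real.exp (-(1 * c))))) :=
      tendsto_nhdsWithin_of_tendsto_nhds (Continuous.tendsto (by fun_prop) _)
    have hr : Tendsto (fun s : ℝ => s * (1 - s * (1 - c)) * C) (𝓝[<] 1)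
        (𝓝 (1 * (1 - 1 * (1 - c)) * C)) :=
      tendsto_nhdsWithin_of_tendsto_nhds (Continuous.tendsto (by fun_prop) _)
    have := le_of_tendsto_of_tendsto hl hr (by
      filter_upwards [Ioo_mem_nhdsLT (zero_lt_one (α := ℝ))] with s hs
      exact (hB.mono (rho_strictAnti ⟨hs.1, hs.2.le⟩ ⟨one_pos, le_rfl⟩ hs.2).le).cost_one_lower_bound
        hs.1 hs.2 hc.1.le hc.2)
    simpa using this
  have hd : HasDerivAt (fun c : ℝ => -Real.exp (-c)) 1 0 :=
    ((hasDerivAt_id (0 : ℝ)).neg.exp).neg.congr_deriv (by simp)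
  have ht := (hasDerivAt_iff_tendsto_slope.1 hd).mono_left
    (nhdsWithin_mono 0 (fun u (hu : 0 < u) => hu.ne') : 𝓝[>] (0 : ℝ) ≤ 𝓝[≠] 0)
  have := le_of_tendsto (ht.const_mul (Real.exp 1)) (b := C) (by
    filter_upwards [Ioc_mem_nhdsGT (zero_lt_one (α := ℝ))] with c hc
    rw [slope_def_field, ← mul_div_assoc, div_le_iff₀ (by simpa using hc.1)]
    have := h1 c hc
    simp only [neg_zero, Real.exp_zero, sub_zero]
    linarith)
  simpa using this

/-- At fixed `c > 0` the lower bound strictly increases with `s`. -/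
theorem lower_bound_strictMono {s t c : ℝ} (hs : 0 < s) (hst : s < t) (ht : t < 1) (hc0 : 0 < c)
    (hc1 : c ≤ 1) {C : ℝ}
    (hC : s * (1 - s * (1 - c)) * C = Real.exp s * (1 - Real.exp (-(s * c)))) :
    t * (1 - t * (1 - c)) * C < Real.exp t * (1 - Real.exp (-(t * c))) := by
  have hval : ∀ r : ℝ, 0 < r →
      Real.exp r * (1 - Real.exp (-(r * c))) = r * ∫ v in (1 - c)..1, Real.exp (r * v) := by
    intro r hr
    rw [intervalIntegral.integral_eq_sub_of_hasDerivAt (f := fun v => Real.exp (r * v) / r)]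
    · have : Real.exp (r * (1 - c)) = Real.exp r * Real.exp (-(r * c)) := by
        rw [← Real.exp_add]; congr 1; ring
      simp only [this, mul_one]
      field_simp
    · intro v _
      refine ((((hasDerivAt_id v).const_mul r).exp).div_const r).congr_deriv ?_
      simp; field_simp
    · exact Continuous.intervalIntegrable (by fun_prop) _ _
  have hlt : ∫ v in (1 - c)..1, Real.exp (s * v) < ∫ v in (1 - c)..1, Real.exp (t * v) := by
    refine intervalIntegral.integral_lt_integral_of_continuousOn_of_le_of_exists_lt (by linarith)
      (by fun_prop) (by fun_prop) (fun v hv => ?_) ⟨1, right_mem_Icc.2 (by linarith), ?_⟩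
    · exact Real.exp_le_exp.2 (mul_le_mul_of_nonneg_right hst.le (by linarith [hv.1]))
    · exact Real.exp_lt_exp.2 (by linarith)
  have ht0 : 0 < t := hs.trans hst
  rw [hval s hs, mul_assoc, mul_right_inj' hs.ne'] at hC
  rw [hval t ht0, mul_assoc]
  refine mul_lt_mul_of_pos_left ?_ ht0
  refine lt_of_le_of_lt ?_ (hC ▸ hlt)
  have hpos : 0 < 1 - s * (1 - c) := by nlinarith
  have hC0 : 0 ≤ C := by
    have : 0 ≤ (1 - s * (1 - c)) * C := by
      rw [hC]
      exact intervalIntegral.integral_nonneg (by linarith) fun v _ => (Real.exp_pos _).le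
    exact nonneg_of_mul_nonneg_right this hpos
  refine mul_le_mul_of_nonneg_right ?_ hC0
  nlinarith

theorem IsRobust.chi_le_cost {ξ : ℝ → ℝ} (hξ : ∀ s ∈ Icc (Real.log 2) 1, IsXi s (ξ s)) {s : ℝ}
    (hs : 0 < s) (hs1 : s ≤ 1) {B : RandStrategy} (hB : IsRobust B (rho s)) :
    chi ξ s ≤ (B.cost 1).toReal := by
  obtain ⟨c, hc0, hc1, hcpos, -, hval, hlow⟩ := exists_parameter hξ hs hs1
  rcases hs1.lt_or_eq with h | rfl
  · have h1 := hB.cost_one_lower_bound hs h hc0 hc1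
    rw [← hlow] at h1
    have := hcpos h
    exact le_of_mul_le_mul_left h1 (mul_pos hs (by nlinarith))
  · refine le_trans ?_ hB.exp_one_le_cost
    have hmul : (1 : ℝ) - 1 * (1 - c) = c := by ring
    rw [hval, div_one]
    refine mul_le_of_le_one_right (Real.exp_pos _).le ?_
    have := mul_nonneg hc0 (Real.exp_pos (-(1 * c))).le
    linarith

theorem theorem1 :
    ∃ ξ : ℝ → ℝ,
      (∀ s ∈ Icc (Real.log 2) 1, IsXi s (ξ s) ∧ ∀ y : ℝ, IsXi s y → y = ξ s) ∧
      ∀ s ∈ Ioc (0 : ℝ) 1,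
        (∃ B : RandStrategy, IsRobust B (rho s) ∧ IsConsistent B (chi ξ s)) ∧
        IsParetoOptimal (rho s) (chi ξ s) ∧
        ∀ B : RandStrategy, IsRobust B (rho s) →
          ENNReal.ofReal (chi ξ s) ≤ RandStrategy.cost B 1 := by
  classical
  set ξ : ℝ → ℝ := fun s => if h : s ∈ Icc (Real.log 2) 1 then (exists_isXi h).choose else 0
    with hξdef
  have hξ : ∀ s ∈ Icc (Real.log 2) 1, IsXi s (ξ s) := fun s hs => by
    simp only [hξdef, dif_pos hs]
    exact (exists_isXi hs).choose_spec
  refine ⟨ξ, fun s hs => ⟨hξ s hs, fun y hy => hy.unique (hξ s hs)⟩, fun s hs => ?_⟩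
  obtain ⟨hs0, hs1⟩ := hs
  obtain ⟨c, hc0, hc1, hcpos, hcs, hval, hlow⟩ := exists_parameter hξ hs0 hs1
  have hex : ∃ B : RandStrategy, IsRobust B (rho s) ∧ IsConsistent B (chi ξ s) := by
    refine ⟨uniformShift hs0 hs1 hc0 hc1 hcs, isRobust_uniformShift hs0 hs1 hc0 hc1 hcs, ?_⟩
    rw [hval, ← cumProfile_one hs0 hs1 hc0 hc1]
    exact isConsistent_uniformShift hs0 hs1 hc0 hc1 hcs
  have hχ : 0 ≤ chi ξ s := by
    rw [hval, ← cumProfile_one hs0 hs1 hc0 hc1]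
    exact cumProfile_nonneg hs0 hs1 hc0 1
  refine ⟨hex, ⟨hex, ?_⟩, fun B hB =>
    ENNReal.ofReal_le_of_le_toReal (hB.chi_le_cost hξ hs0 hs1)⟩
  rintro ρ' hρ' ⟨B, hB, hBχ⟩
  have hcost : (B.cost 1).toReal ≤ chi ξ s := ENNReal.toReal_le_of_le_ofReal hχ hBχ
  rcases hs1.lt_or_eq with h | rfl
  · -- `B` is even `ρ(t)`-robust for some `t > s`, where the lower bound for this `c` exceeds `χ(s)`
    have hcont : ContinuousAt rho s := Real.continuous_exp.continuousAt.div continuousAt_id hs0.ne'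
    obtain ⟨t, htρ, hst, ht1⟩ := (((hcont.eventually_const_lt hρ').filter_mono
      (nhdsWithin_le_nhds (s := Ioi s))).and (Ioo_mem_nhdsGT h)).exists
    have ht0 := hs0.trans hst
    have h1 := (hB.mono htρ.le).cost_one_lower_bound ht0 ht1 hc0 hc1
    have h2 := lower_bound_strictMono hs0 hst ht1 (hcpos h) hc1 hlow
    have h3 : 0 ≤ t * (1 - t * (1 - c)) := mul_nonneg ht0.le (by nlinarith)
    linarith [mul_le_mul_of_nonneg_left hcost h3]
  · -- for `s = 1`, already the robustness bound at the target `1` is violated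
    have h1 := (hB.mono hρ'.le).exp_one_le_cost
    have h2 : rho 1 = Real.exp 1 := by simp [rho]
    have h3 := hB 1 one_pos
    rw [mul_one] at h3
    have h4 : (B.cost 1).toReal ≤ max ρ' 0 :=
      ENNReal.toReal_le_of_le_ofReal (le_max_right _ _)
        (h3.trans (ENNReal.ofReal_le_ofReal (le_max_left _ _)))
    have h5 : max ρ' 0 < Real.exp 1 := max_lt (h2 ▸ hρ') (Real.exp_pos 1)
    linarith
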